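/- Let $H$ be a smooth (Hausdorff) manifold of dimension $n+1$ with a smooth Riemannian metric $g$, and let $\mathcal W\subset H$ be a compact smoothly embedded hypersurface with unit normal field $\nu$, whose mean curvature $\operatorname{tr} g(\nabla_{\cdot}\,\cdot,\nu)$ with respect to $\nu$ is positive everywhere (so that a round sphere has positive mean curvature with respect to its inner normal). Let $\Phi:(-\sigma,\sigma)\times\mathcal W\to H$, $\sigma>0$, be the normal Fermi decomposition along $\mathcal W$: a diffeomorphism onto an open subset with $\Phi(0,p)=p$, $\partial_t\Phi(0,p)=\nu(p)$ and $\Phi^*g=dt^2+g_t$, where $g_t$ is the metric on $\mathcal W$ induced by $p\mapsto\Phi(t,p)$. The side $t\ge 0$ is the one that is kept; the side $t<0$ of $\mathcal W$ is discarded. For $k,\delta>0$ let $\mathcal H(k,\delta)$ be the set of smooth even functions $h:\mathbb R\to(0,\infty)$ with $h(t)=-t$ for $t\le-\delta$, $h(t)=t$ for $t\ge\delta$, $|h'|\le 1$, $h''\ge 0$, $|h''|\ge k\,|h'+1|$ on $(-\infty,0]$ and $|h''|\ge k\,|h'-1|$ on $[0,\infty)$. Then there are $\sigma_1\in(0,\sigma]$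 and $k_0>0$ such that for all $k\ge k_0$ the following holds. 1. For every $\delta\in(0,\sigma_1/2)$ and every $h\in\mathcal H(k,\delta)$, the metric obtained from $g$ on the kept side by replacing $dt^2+g_t$ by $dt^2+g_{h(t)}$ on $[0,\sigma)\times\mathcal W$ extends to a smooth Riemannian metric $g'$ on $H$ (that is, $\Phi^*g'=dt^2+g_{h(t)}$ on $[0,\sigma)\times\mathcal W$), with $g'=g$ outside $\Phi((-\delta,\delta)\times\mathcal W)$, such that $\operatorname{scal}(g')\ge\operatorname{scal}(g)$ at all points of $H\setminus\Phi((-\delta,0)\times\mathcal W)$, in particular on $\Phi([0,\sigma)\times\mathcal W)$, and $\mathcal W$ is totally geodesic with respect to $g'$. 2. For every neighborhood $U$ of $\mathcal W$ in $H$ there are $\delta\in(0,\sigma_1/2)$, $h\in\mathcal H(k,\delta)$ and a metric $g'$ with all the properties in 1 such that moreover $g'=g$ on $H\setminus U$. -/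

import Mathlib

open scoped Manifold ContDiff Topology

noncomputable section

namespace FermiDoubling

/-! ### Curvature of a metric in coordinates

`γ` is a field of bilinear forms on a finite-dimensional vector space `E` (the coordinate space). -/

section Coordinates

variable {E : Type*} [NormedAddCommGroup E] [NormedSpace ℝ E] [FiniteDimensional ℝ E]

/-- The Christoffel map `Γ_y(v, w) = Γ^k_{ij} v^i w^j ∂_k` of the Levi-Civita connection of `γ`:
the vector `u` with `γ(u, z) = (1/2) (∂_v γ(w, z) + ∂_w γ(v, z) - ∂_z γ(v, w))` for all `z`. -/
def christoffel (γ : E → E →L[ℝ] E →L[ℝ] ℝ) (y v w : E) : E :=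
  (γ y).inverse ((1 / 2 : ℝ) •
    (fderiv ℝ γ y v w + fderiv ℝ γ y w v - ((fderiv ℝ γ y).flip v).flip w))

/-- The Riemann curvature tensor `R(u, v) w = ∇_u ∇_v w - ∇_v ∇_u w` (for constant coordinate
fields `u, v, w`). -/
def riemann (γ : E → E →L[ℝ] E →L[ℝ] ℝ) (y u v w : E) : E :=
  fderiv ℝ (fun y' => christoffel γ y' v w) y u - fderiv ℝ (fun y' => christoffel γ y' u w) y v
    + christoffel γ y u (christoffel γ y v w) - christoffel γ y v (christoffel γ y u w)

/-- The Ricci tensor `Ric(v, w)`, the trace of `u ↦ R(u, v) w`. -/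
def ricci (γ : E → E →L[ℝ] E →L[ℝ] ℝ) (y v w : E) : ℝ :=
  ∑ i, (Module.finBasis ℝ E).coord i (riemann γ y (Module.finBasis ℝ E i) v w)

/-- The trace `∑ i j, γ^{ij} B(e_i, e_j)` of a bilinear form `B` with respect to a scalar product
`γ`, where `γ^{ij} = e^i (γ⁻¹ e^j)` is the inverse matrix of `γ(e_i, e_j)`. -/
def metricTrace (γ : E →L[ℝ] E →L[ℝ] ℝ) (B : E → E → ℝ) : ℝ :=
  ∑ i, ∑ j, (Module.finBasis ℝ E).coord i
      (γ.inverse (LinearMap.toContinuousLinearMap ((Module.finBasis ℝ E).coord j))) *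
    B (Module.finBasis ℝ E i) (Module.finBasis ℝ E j)

/-- Scalar curvature in coordinates. -/
def scalCoord (γ : E → E →L[ℝ] E →L[ℝ] ℝ) (y : E) : ℝ :=
  metricTrace (γ y) (ricci γ y)

end Coordinates

/-! ### Riemannian manifolds and hypersurfaces -/

section Manifold

variable {m n : ℕ}
  {H : Type*} [TopologicalSpace H] [ChartedSpace (EuclideanSpace ℝ (Fin m)) H]
  [IsManifold (𝓡 m) ∞ H]
  {W : Type*} [TopologicalSpace W] [ChartedSpace (EuclideanSpace ℝ (Fin n)) W]

variable (m H) in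
/-- Smooth Riemannian metrics on the manifold `H`. -/
abbrev Metric : Type _ :=
  Bundle.ContMDiffRiemannianMetric (𝓡 m) ∞ (EuclideanSpace ℝ (Fin m))
    (fun x : H => TangentSpace (𝓡 m) x)

/-- The coordinate expression `g_{ij}` of the metric `g` in the preferred chart at `x`. -/
def coordMetric (g : Metric m H) (x : H) (y : EuclideanSpace ℝ (Fin m)) :
    EuclideanSpace ℝ (Fin m) →L[ℝ] EuclideanSpace ℝ (Fin m) →L[ℝ] ℝ :=
  ContinuousLinearMap.bilinearComp
    (E := EuclideanSpace ℝ (Fin m)) (F := EuclideanSpace ℝ (Fin m))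
    (g.inner ((extChartAt (𝓡 m) x).symm y))
    (mfderiv 𝓘(ℝ, EuclideanSpace ℝ (Fin m)) (𝓡 m) (extChartAt (𝓡 m) x).symm y)
    (mfderiv 𝓘(ℝ, EuclideanSpace ℝ (Fin m)) (𝓡 m) (extChartAt (𝓡 m) x).symm y)

/-- The scalar curvature of `g` at `x`. -/
def scal (g : Metric m H) (x : H) : ℝ :=
  scalCoord (coordMetric g x) (extChartAt (𝓡 m) x x)

/-- The second derivative `∇dι(v, w)` of a map `ι : W → H` at `p`, a vector tangent to `H` at
`ι p`, for `v, w` tangent to `W` at `p`; in coordinates it is `∂_v ∂_w ι + Γ(∂_v ι, ∂_w ι)`.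
Modulo vectors tangent to the hypersurface it is the covariant derivative `∇_v w` of `H`.
Tangent vectors at a point are, as always in Mathlib, written in the preferred chart there. -/
def secondDeriv (g : Metric m H) (ι : W → H) (p : W) (v w : TangentSpace (𝓡 n) p) :
    TangentSpace (𝓡 m) (ι p) :=
  let f : EuclideanSpace ℝ (Fin n) → EuclideanSpace ℝ (Fin m) :=
    writtenInExtChartAt (𝓡 n) (𝓡 m) p ι
  let y : EuclideanSpace ℝ (Fin n) := extChartAt (𝓡 n) p p
  (fderiv ℝ (fun y' => fderiv ℝ f y' w) y v
    + christoffel (coordMetric g (ι p)) (f y) (fderiv ℝ f y v) (fderiv ℝ f y w) :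
      EuclideanSpace ℝ (Fin m))

/-- The hypersurface `ι : W → H` is totally geodesic: its second fundamental form, the normal part
of `∇_v w` for tangent `v, w`, vanishes. -/
def IsTotallyGeodesic (g : Metric m H) (ι : W → H) : Prop :=
  ∀ (p : W) (v w : TangentSpace (𝓡 n) p),
    secondDeriv g ι p v w ∈ Set.range (mfderiv (𝓡 n) (𝓡 m) ι p)

/-- The metric induced by `g` on `W` by the immersion `ι`, at the point `p`. -/
def inducedMetric (g : Metric m H) (ι : W → H) (p : W) :
    EuclideanSpace ℝ (Fin n) →L[ℝ] EuclideanSpace ℝ (Fin n) →L[ℝ] ℝ :=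
  ContinuousLinearMap.bilinearComp
    (E := EuclideanSpace ℝ (Fin m)) (F := EuclideanSpace ℝ (Fin m))
    (g.inner (ι p)) (mfderiv (𝓡 n) (𝓡 m) ι p) (mfderiv (𝓡 n) (𝓡 m) ι p)

/-- The mean curvature of the hypersurface `ι` with respect to the unit normal field `ν`: the trace
of the second fundamental form `(v, w) ↦ g(∇_v w, ν)`. For a round sphere in Euclidean space it is
positive when `ν` points inwards. -/
def meanCurvature (g : Metric m H) (ι : W → H) (ν : ∀ p : W, TangentSpace (𝓡 m) (ι p)) (p : W) :
    ℝ :=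
  metricTrace (inducedMetric (n := n) g ι p)
    (fun v w => g.inner (ι p) (secondDeriv (n := n) g ι p v w) (ν p))

/-! ### Fermi decompositions -/

/-- The coordinate field `∂/∂t` of a map `Φ : ℝ × W → H`. -/
def dt (Φ : ℝ × W → H) (t : ℝ) (p : W) : TangentSpace (𝓡 m) (Φ (t, p)) :=
  mfderiv 𝓘(ℝ, ℝ) (𝓡 m) (fun s : ℝ => Φ (s, p)) t (1 : ℝ)

/-- The differential of the slice `p ↦ Φ (t, p)`. -/
def dslice (Φ : ℝ × W → H) (t : ℝ) (p : W) (v : TangentSpace (𝓡 n) p) :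
    TangentSpace (𝓡 m) (Φ (t, p)) :=
  mfderiv (𝓡 n) (𝓡 m) (fun q : W => Φ (t, q)) p v

/-- The metric `g_t` on `W` obtained by restricting `g` to the slice `N_t = Φ ({t} × W)`. -/
def sliceMetric (g : Metric m H) (Φ : ℝ × W → H) (t : ℝ) (p : W) (v w : TangentSpace (𝓡 n) p) :
    ℝ :=
  g.inner (Φ (t, p)) (dslice Φ t p v) (dslice Φ t p w)

/-- The pull-back of `g` by `Φ` is `dt² + γ t` at all points of `T × W`. -/
def HasForm (g : Metric m H) (Φ : ℝ × W → H) (T : Set ℝ)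
    (γ : ℝ → ∀ p : W, TangentSpace (𝓡 n) p → TangentSpace (𝓡 n) p → ℝ) : Prop :=
  ∀ t ∈ T, ∀ p : W,
    g.inner (Φ (t, p)) (dt Φ t p) (dt Φ t p) = 1 ∧
    (∀ v, g.inner (Φ (t, p)) (dt Φ t p) (dslice (n := n) Φ t p v) = 0) ∧
    ∀ v w, g.inner (Φ (t, p)) (dslice (n := n) Φ t p v) (dslice (n := n) Φ t p w) = γ t p v w

/-- `Φ` is the normal Fermi decomposition of width `σ` along the hypersurface `ι` with unit normal
field `ν`: a diffeomorphism of `(-σ, σ) × W` onto an open subset of `H`, starting on `W` with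
velocity `ν`, in which the metric is `dt² + g_t`. -/
structure IsFermi (g : Metric m H) (ι : W → H) (ν : ∀ p : W, TangentSpace (𝓡 m) (ι p))
    (σ : ℝ) (Φ : ℝ × W → H) : Prop where
  pos : 0 < σ
  isLocalDiffeomorphOn :
    IsLocalDiffeomorphOn (𝓘(ℝ, ℝ).prod (𝓡 n)) (𝓡 m) ∞ Φ (Set.Ioo (-σ) σ ×ˢ Set.univ)
  injOn : Set.InjOn Φ (Set.Ioo (-σ) σ ×ˢ Set.univ)
  initial : ∀ p : W,
    tangentMap 𝓘(ℝ, ℝ) (𝓡 m) (fun t : ℝ => Φ (t, p)) ⟨0, (1 : ℝ)⟩ = ⟨ι p, ν p⟩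
  hasForm : HasForm g Φ (Set.Ioo (-σ) σ) (sliceMetric (n := n) g Φ)

end Manifold

/-- The reparametrizing functions `h` with constants `k` and `δ`. -/
structure IsCompression (k δ : ℝ) (h : ℝ → ℝ) : Prop where
  smooth : ContDiff ℝ ∞ h
  pos : ∀ t, 0 < h t
  left : ∀ t, t ≤ -δ → h t = -t
  right : ∀ t, δ ≤ t → h t = t
  even : ∀ t, h (-t) = h t
  abs_deriv_le : ∀ t, |deriv h t| ≤ 1
  convex : ∀ t, 0 ≤ deriv (deriv h) t
  growth_left : ∀ t, t ≤ 0 → k * |deriv h t + 1| ≤ |deriv (deriv h) t|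
  growth_right : ∀ t, 0 ≤ t → k * |deriv h t - 1| ≤ |deriv (deriv h) t|

/-- The metric `g'` arises from `g` by replacing `dt² + g_t` by `dt² + g_{h(t)}` on `[0, σ) × W`;
it is unchanged off the part `Φ ((-δ, δ) × W)` of the Fermi neighbourhood, and on the discarded
side `t < 0` it is any smooth continuation. -/
structure IsReplacement {m n : ℕ}
    {H : Type*} [TopologicalSpace H] [ChartedSpace (EuclideanSpace ℝ (Fin m)) H]
    [IsManifold (𝓡 m) ∞ H]
    {W : Type*} [TopologicalSpace W] [ChartedSpace (EuclideanSpace ℝ (Fin n)) W]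
    (g : Metric m H) (Φ : ℝ × W → H) (σ δ : ℝ) (h : ℝ → ℝ) (g' : Metric m H) : Prop where
  hasForm : HasForm g' Φ (Set.Ico 0 σ) (fun t => sliceMetric (n := n) g Φ (h t))
  eq_off : ∀ x, x ∉ Φ '' (Set.Ioo (-δ) δ ×ˢ Set.univ) → g'.inner x = g.inner x

end FermiDoubling

end

set_option maxSynthPendingDepth 3

noncomputable section

namespace FermiDoubling

/-!
In the Fermi chart the metric is `dt² + g_t`, and replacing `t` by `h t` acts on its second jet by
the chain rule. The only new second order term is `h'' ∂_t g_t`, and the scalar curvature is affine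
in it: at time `t` it becomes `S (h t, h' t) - h'' tr (∂_t g_t)`, the trace being taken at time
`h t`, where `S (s, a)` is the scalar curvature at `τ = 0` of `dτ² + g_{s + a τ}`, so that
`S (t, 1)` is the original one. Convexity of `h` gives `0 ≤ h t - t ≤ δ (1 - h')`, hence
`|S (h t, h') - S (t, 1)| ≤ L (1 - h')` for a Lipschitz constant `L` of `S`. Since `tr (∂_t g_t)` is
`-2` times the mean curvature, it is at most some `-c < 0` near `W`, and `h'' ≥ k (1 - h')` makes
the last term at least `c k (1 - h')`. So `k ≥ L / c` suffices, and `L` and `c` can be chosen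
uniformly on the compact `W`. As `h` is even, `h' 0 = 0`, and the second fundamental form
`-h' ∂_t g_t / 2` of `W` vanishes.
-/

/-! ### Bilinear forms and traces -/

section Form

variable {E F G V : Type*} [NormedAddCommGroup E] [NormedSpace ℝ E]
  [NormedAddCommGroup F] [NormedSpace ℝ F] [NormedAddCommGroup G] [NormedSpace ℝ G]
  [NormedAddCommGroup V] [NormedSpace ℝ V]

variable (E) in
/-- Continuous bilinear forms on `E`, the values of a metric written in coordinates. -/
abbrev Form : Type _ := E →L[ℝ] E →L[ℝ] ℝ

theorem contDiffAt_flip {n : ℕ∞ω} {b : G → E →L[ℝ] F →L[ℝ] V} {x : G} (hb : ContDiffAt ℝ n b x) :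
    ContDiffAt ℝ n (fun x => (b x).flip) x :=
  (ContinuousLinearMap.flipₗᵢ ℝ E F V).contDiff.contDiffAt.comp x hb

theorem contDiffAt_bilinearComp {E' F' : Type*} [NormedAddCommGroup E'] [NormedSpace ℝ E']
    [NormedAddCommGroup F'] [NormedSpace ℝ F'] {n : ℕ∞ω} {b : G → E →L[ℝ] F →L[ℝ] V}
    {A : G → E' →L[ℝ] E} {B : G → F' →L[ℝ] F} {x : G}
    (hb : ContDiffAt ℝ n b x) (hA : ContDiffAt ℝ n A x) (hB : ContDiffAt ℝ n B x) :
    ContDiffAt ℝ n (fun x => (b x).bilinearComp (A x) (B x)) x :=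
  contDiffAt_flip ((contDiffAt_flip (hb.clm_comp hA)).clm_comp hB)

theorem isInvertible_bilinearComp {g : Form F} {A : E →L[ℝ] F}
    (hg : g.IsInvertible) (hA : A.IsInvertible) : (g.bilinearComp A A).IsInvertible := by
  obtain ⟨a, rfl⟩ := hA
  obtain ⟨e, rfl⟩ := hg
  refine ⟨(a.trans e).trans (a.symm.arrowCongr (ContinuousLinearEquiv.refl ℝ ℝ)), ?_⟩
  ext v w
  simp [ContinuousLinearEquiv.arrowCongr_apply]

theorem contDiffAt_inverse [CompleteSpace E] {n : ℕ∞ω} {A : G → E →L[ℝ] F} {x : G}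
    (hA : ContDiffAt ℝ n A x) (hinv : (A x).IsInvertible) :
    ContDiffAt ℝ n (fun x => (A x).inverse) x :=
  hinv.contDiffAt_map_inverse.comp x hA

theorem eventually_isInvertible [CompleteSpace E] {X : Type*} [TopologicalSpace X]
    {A : X → E →L[ℝ] F} {x : X} (hA : ContinuousAt A x) (hinv : (A x).IsInvertible) :
    ∀ᶠ y in 𝓝 x, (A y).IsInvertible := by
  obtain ⟨a, ha⟩ := hinv
  exact hA (ha ▸ a.nhds)

theorem isInvertible_of_posDef [FiniteDimensional ℝ E] {b : Form E}
    (hb : ∀ v, v ≠ 0 → 0 < b v v) : b.IsInvertible := by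
  have hinj : Function.Injective b :=
    (injective_iff_map_eq_zero b).2 fun v hv => by
      by_contra hne
      simpa [hv] using hb v hne
  have hdim : Module.finrank ℝ E = Module.finrank ℝ (E →L[ℝ] ℝ) :=
    (Subspace.dual_finrank_eq (K := ℝ) (V := E)).symm.trans
      (LinearEquiv.finrank_eq LinearMap.toContinuousLinearMap)
  exact ⟨(LinearEquiv.ofInjectiveOfFinrankEq b.toLinearMap hinj hdim).toContinuousLinearEquiv, rfl⟩

end Form

section Trace

variable {E F : Type*} [NormedAddCommGroup E] [NormedSpace ℝ E] [FiniteDimensional ℝ E]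
  [NormedAddCommGroup F] [NormedSpace ℝ F] [FiniteDimensional ℝ F]

/-- The trace of an endomorphism, as a continuous linear functional. -/
def endTrace : (E →L[ℝ] E) →L[ℝ] ℝ :=
  LinearMap.toContinuousLinearMap (LinearMap.trace ℝ E ∘ₗ ContinuousLinearMap.coeLM ℝ)

theorem endTrace_apply (T : E →L[ℝ] E) : endTrace T = LinearMap.trace ℝ E T := rfl

theorem endTrace_eq_sum {κ : Type*} [Fintype κ] (b : Module.Basis κ ℝ E) (T : E →L[ℝ] E) :
    endTrace T = ∑ i, b.coord i (T (b i)) := by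
  classical
  rw [endTrace_apply, LinearMap.trace_eq_matrix_trace ℝ b, Matrix.trace]
  simp [LinearMap.toMatrix_apply]

theorem endTrace_smulRight (τ : E →L[ℝ] ℝ) (e : E) : endTrace (τ.smulRight e) = τ e :=
  LinearMap.trace_smulRight (τ : E →ₗ[ℝ] ℝ) e

theorem endTrace_eq_of_semiconj {S : E →L[ℝ] E} {T : F →L[ℝ] F} (a : E ≃L[ℝ] F)
    (h : ∀ v, a (S v) = T (a v)) : endTrace S = endTrace T := by
  rw [endTrace_apply, endTrace_apply, ← LinearMap.trace_conj' (S : E →ₗ[ℝ] E) a.toLinearEquiv]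
  congr 1
  ext x
  simpa [LinearEquiv.conj_apply] using h (a.symm x)

theorem metricTrace_eq_endTrace (g B : Form E) :
    metricTrace g (fun v w => B v w) = endTrace (g.inverse ∘L B) := by
  rw [endTrace_eq_sum (Module.finBasis ℝ E), metricTrace]
  refine Finset.sum_congr rfl fun i _ => ?_
  have hB : B (Module.finBasis ℝ E i) = ∑ j, B (Module.finBasis ℝ E i) (Module.finBasis ℝ E j) •
      LinearMap.toContinuousLinearMap ((Module.finBasis ℝ E).coord j) := by
    ext x
    conv_lhs => rw [← (Module.finBasis ℝ E).sum_repr x]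
    simp only [map_sum, map_smul, LinearMap.coe_toContinuousLinearMap', smul_eq_mul, sum_apply,
      smul_apply, Module.Basis.coord_apply, mul_comm]
  conv_rhs => rw [ContinuousLinearMap.comp_apply, hB, map_sum, map_sum]
  exact Finset.sum_congr rfl fun j _ => by rw [map_smul, map_smul, smul_eq_mul, mul_comm]

theorem metricTrace_bilinearComp (a : E ≃L[ℝ] F) {g : Form F} (hg : g.IsInvertible) (B : Form F) :
    metricTrace (g.bilinearComp (a : E →L[ℝ] F) (a : E →L[ℝ] F)) (fun v w => B (a v) (a w)) =
      metricTrace g (fun v w => B v w) := by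
  let a' : E →L[ℝ] F := a
  change metricTrace (g.bilinearComp a' a') (fun v w => B.bilinearComp a' a' v w) = _
  rw [metricTrace_eq_endTrace, metricTrace_eq_endTrace]
  refine endTrace_eq_of_semiconj a fun v => hg.injective <| ContinuousLinearMap.ext fun z' => ?_
  obtain ⟨z, rfl⟩ := a.surjective z'
  have hi : (g.bilinearComp a' a').IsInvertible := isInvertible_bilinearComp hg ⟨a, rfl⟩
  have h := DFunLike.congr_fun (hi.self_apply_inverse (B.bilinearComp a' a' v)) z
  simpa [hg.self_apply_inverse, a'] using h

end Trace

/-! ### The curvature of a metric in terms of its second jet -/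

section Curvature

variable {E : Type*} [NormedAddCommGroup E] [NormedSpace ℝ E]

/-- The Christoffel symbols of the first kind
`Γ_{vw,z} = (1/2) (∂_v γ(w, z) + ∂_w γ(v, z) - ∂_z γ(v, w))`, as a linear function of the
derivative of the metric. -/
def lowerChristoffel : (E →L[ℝ] Form E) →L[ℝ] (E →L[ℝ] Form E) :=
  let swap₁₂ : (E →L[ℝ] Form E) →L[ℝ] (E →L[ℝ] Form E) :=
    (ContinuousLinearMap.flipₗᵢ ℝ E E (E →L[ℝ] ℝ)).toContinuousLinearEquiv.toContinuousLinearMap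
  let swap : Form E →L[ℝ] Form E :=
    (ContinuousLinearMap.flipₗᵢ ℝ E E ℝ).toContinuousLinearEquiv.toContinuousLinearMap
  (1 / 2 : ℝ) • (ContinuousLinearMap.id ℝ _ + swap₁₂ -
    (ContinuousLinearMap.compL ℝ E (Form E) (Form E) swap).comp swap₁₂)

theorem lowerChristoffel_apply (d : E →L[ℝ] Form E) (v w z : E) :
    lowerChristoffel d v w z = (1 / 2 : ℝ) * (d v w z + d w v z - d z v w) := by
  simp [lowerChristoffel]

/-- The Christoffel map, as a function of the metric `g` and its derivative `d`. -/
def christoffelOf (g : Form E) (d : E →L[ℝ] Form E) : E →L[ℝ] E →L[ℝ] E :=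
  (ContinuousLinearMap.compL ℝ E (E →L[ℝ] ℝ) E g.inverse).comp (lowerChristoffel d)

theorem christoffelOf_apply (g : Form E) (d : E →L[ℝ] Form E) (v w : E) :
    christoffelOf g d v w = g.inverse (lowerChristoffel d v w) := rfl

theorem christoffel_eq (γ : E → Form E) (y v w : E) :
    christoffel γ y v w = christoffelOf (γ y) (fderiv ℝ γ y) v w := rfl

/-- The derivative of the Christoffel map, as a function of the second jet `(g, d, dd)` of the
metric: the formula comes from differentiating `g (Γ(v, w)) = Γ_{vw,·}`. -/
def christoffelDerivOf (g : Form E) (d : E →L[ℝ] Form E) (dd : E →L[ℝ] E →L[ℝ] Form E) :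
    E →L[ℝ] E →L[ℝ] E →L[ℝ] E :=
  (ContinuousLinearMap.compL ℝ E (Form E) (E →L[ℝ] E)
    (ContinuousLinearMap.compL ℝ E (E →L[ℝ] ℝ) E g.inverse)).comp
  (lowerChristoffel.comp dd -
    (ContinuousLinearMap.compL ℝ E E (E →L[ℝ] ℝ)).bilinearComp d (christoffelOf g d))

theorem christoffelDerivOf_apply (g : Form E) (d : E →L[ℝ] Form E)
    (dd : E →L[ℝ] E →L[ℝ] Form E) (u v w : E) :
    christoffelDerivOf g d dd u v w =
      g.inverse (lowerChristoffel (dd u) v w - d u (christoffelOf g d v w)) := rfl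

/-- The curvature `R(u, v) w` of the connection with Christoffel map `Γ`, whose derivative is
`DΓ`. -/
def curvatureOf (Γ : E →L[ℝ] E →L[ℝ] E) (DΓ : E →L[ℝ] E →L[ℝ] E →L[ℝ] E) :
    E →L[ℝ] E →L[ℝ] E →L[ℝ] E :=
  DΓ + (ContinuousLinearMap.compL ℝ E E E).bilinearComp Γ Γ -
    (DΓ + (ContinuousLinearMap.compL ℝ E E E).bilinearComp Γ Γ).flip

theorem curvatureOf_apply (Γ : E →L[ℝ] E →L[ℝ] E) (DΓ : E →L[ℝ] E →L[ℝ] E →L[ℝ] E) (u v w : E) :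
    curvatureOf Γ DΓ u v w = DΓ u v w + Γ u (Γ v w) - (DΓ v u w + Γ v (Γ u w)) := rfl

section Calculus

variable {G : Type*} [NormedAddCommGroup G] [NormedSpace ℝ G] {n : ℕ∞ω} {x : G} {g : G → Form E}
  {d : G → E →L[ℝ] Form E} {dd : G → E →L[ℝ] E →L[ℝ] Form E}

theorem contDiffAt_curvatureOf {Γ : G → E →L[ℝ] E →L[ℝ] E} {DΓ : G → E →L[ℝ] E →L[ℝ] E →L[ℝ] E}
    (hΓ : ContDiffAt ℝ n Γ x) (hDΓ : ContDiffAt ℝ n DΓ x) :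
    ContDiffAt ℝ n (fun x => curvatureOf (Γ x) (DΓ x)) x := by
  have hA := hDΓ.add (contDiffAt_bilinearComp
    (contDiffAt_const (c := ContinuousLinearMap.compL ℝ E E E)) hΓ hΓ)
  exact hA.sub (contDiffAt_flip hA)

variable [CompleteSpace E]

theorem contDiffAt_christoffelOf (hg : ContDiffAt ℝ n g x) (hinv : (g x).IsInvertible)
    (hd : ContDiffAt ℝ n d x) : ContDiffAt ℝ n (fun x => christoffelOf (g x) (d x)) x :=
  ((ContinuousLinearMap.contDiff _).contDiffAt.comp x (contDiffAt_inverse hg hinv)).clm_comp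
    ((ContinuousLinearMap.contDiff _).contDiffAt.comp x hd)

theorem contDiffAt_christoffelDerivOf (hg : ContDiffAt ℝ n g x) (hinv : (g x).IsInvertible)
    (hd : ContDiffAt ℝ n d x) (hdd : ContDiffAt ℝ n dd x) :
    ContDiffAt ℝ n (fun x => christoffelDerivOf (g x) (d x) (dd x)) x := by
  refine ContDiffAt.clm_comp ((ContinuousLinearMap.contDiff _).contDiffAt.comp x
    ((ContinuousLinearMap.contDiff _).contDiffAt.comp x (contDiffAt_inverse hg hinv))) ?_
  exact (contDiffAt_const.clm_comp hdd).sub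
    (contDiffAt_bilinearComp contDiffAt_const hd (contDiffAt_christoffelOf hg hinv hd))

theorem hasFDerivAt_christoffelOf {γ : E → Form E} {y : E} (hγ : ContDiffAt ℝ 2 γ y)
    (hinv : (γ y).IsInvertible) :
    HasFDerivAt (fun y' => christoffelOf (γ y') (fderiv ℝ γ y'))
      (christoffelDerivOf (γ y) (fderiv ℝ γ y) (fderiv ℝ (fderiv ℝ γ) y)) y := by
  have hγ₁ := (hγ.differentiableAt two_ne_zero).hasFDerivAt
  have hdγ : ContDiffAt ℝ 1 (fderiv ℝ γ) y := hγ.fderiv_right (by norm_num)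
  have hdγ₁ := (hdγ.differentiableAt one_ne_zero).hasFDerivAt
  have hΓ : DifferentiableAt ℝ (fun y' => christoffelOf (γ y') (fderiv ℝ γ y')) y :=
    (contDiffAt_christoffelOf (hγ.of_le one_le_two) hinv hdγ).differentiableAt one_ne_zero
  convert hΓ.hasFDerivAt using 1
  ext u v w
  have hprod := hγ₁.clm_apply ((hΓ.hasFDerivAt.clm_apply (hasFDerivAt_const v y)).clm_apply
    (hasFDerivAt_const w y))
  have hlower := ((lowerChristoffel.hasFDerivAt.comp y hdγ₁).clm_apply
    (hasFDerivAt_const v y)).clm_apply (hasFDerivAt_const w y)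
  have heq : (fun y' => γ y' (christoffelOf (γ y') (fderiv ℝ γ y') v w)) =ᶠ[𝓝 y]
      fun y' => lowerChristoffel (fderiv ℝ γ y') v w := by
    filter_upwards [eventually_isInvertible hγ.continuousAt hinv] with y' hy'
    rw [christoffelOf_apply, hy'.self_apply_inverse]
  have key := DFunLike.congr_fun ((hprod.congr_of_eventuallyEq heq.symm).unique hlower) u
  simp only [ContinuousLinearMap.comp_zero, zero_add, add_apply, ContinuousLinearMap.comp_apply,
    ContinuousLinearMap.flip_apply, Function.comp_apply] at key
  rw [christoffelDerivOf_apply, hinv.inverse_apply_eq, ← key, add_sub_cancel_right]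

theorem riemann_eq {γ : E → Form E} {y : E} (hγ : ContDiffAt ℝ 2 γ y)
    (hinv : (γ y).IsInvertible) (u v w : E) :
    riemann γ y u v w = curvatureOf (christoffelOf (γ y) (fderiv ℝ γ y))
      (christoffelDerivOf (γ y) (fderiv ℝ γ y) (fderiv ℝ (fderiv ℝ γ) y)) u v w := by
  have hΓ (v w : E) := ((hasFDerivAt_christoffelOf hγ hinv).clm_apply
    (hasFDerivAt_const v y)).clm_apply (hasFDerivAt_const w y)
  simp only [riemann, christoffel_eq, (hΓ _ _).fderiv, curvatureOf_apply]
  simp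
  abel

end Calculus

theorem apply_christoffel {γ : E → Form E} {y : E} (hinv : (γ y).IsInvertible) (v w z : E) :
    γ y (christoffel γ y v w) z =
      (1 / 2 : ℝ) * (fderiv ℝ γ y v w z + fderiv ℝ γ y w v z - fderiv ℝ γ y z v w) := by
  rw [christoffel_eq, christoffelOf_apply, hinv.self_apply_inverse, lowerChristoffel_apply]

variable [FiniteDimensional ℝ E]

/-- The Ricci form `(v, w) ↦ tr (u ↦ R(u, v) w)` of a curvature tensor. -/
def ricciOf (R : E →L[ℝ] E →L[ℝ] E →L[ℝ] E) : Form E :=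
  (ContinuousLinearMap.compL ℝ E (E →L[ℝ] E) ℝ endTrace).comp
    ((ContinuousLinearMap.flipₗᵢ ℝ E E E).toContinuousLinearEquiv.toContinuousLinearMap.comp R.flip)

theorem ricciOf_apply (R : E →L[ℝ] E →L[ℝ] E →L[ℝ] E) (v w : E) :
    ricciOf R v w = endTrace ((R.flip v).flip w) := rfl

/-- The scalar curvature, as a function of the second jet `(g, d, dd)` of the metric. -/
def scalOf (g : Form E) (d : E →L[ℝ] Form E) (dd : E →L[ℝ] E →L[ℝ] Form E) : ℝ :=
  endTrace (g.inverse.comp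
    (ricciOf (curvatureOf (christoffelOf g d) (christoffelDerivOf g d dd))))

theorem ricci_eq {γ : E → Form E} {y : E} (hγ : ContDiffAt ℝ 2 γ y)
    (hinv : (γ y).IsInvertible) (v w : E) :
    ricci γ y v w = ricciOf (curvatureOf (christoffelOf (γ y) (fderiv ℝ γ y))
      (christoffelDerivOf (γ y) (fderiv ℝ γ y) (fderiv ℝ (fderiv ℝ γ) y))) v w := by
  simp only [ricci, riemann_eq hγ hinv, ricciOf_apply, endTrace_eq_sum (Module.finBasis ℝ E),
    ContinuousLinearMap.flip_apply]

theorem scalCoord_eq_scalOf {γ : E → Form E} {y : E} (hγ : ContDiffAt ℝ 2 γ y)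
    (hinv : (γ y).IsInvertible) :
    scalCoord γ y = scalOf (γ y) (fderiv ℝ γ y) (fderiv ℝ (fderiv ℝ γ) y) := by
  rw [scalCoord, scalOf, ← metricTrace_eq_endTrace]
  congr 1
  ext v w
  exact ricci_eq hγ hinv v w

theorem contDiffAt_scalOf {G : Type*} [NormedAddCommGroup G] [NormedSpace ℝ G] {n : ℕ∞ω} {x : G}
    {g : G → Form E} {d : G → E →L[ℝ] Form E} {dd : G → E →L[ℝ] E →L[ℝ] Form E}
    (hg : ContDiffAt ℝ n g x) (hinv : (g x).IsInvertible)
    (hd : ContDiffAt ℝ n d x) (hdd : ContDiffAt ℝ n dd x) :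
    ContDiffAt ℝ n (fun x => scalOf (g x) (d x) (dd x)) x := by
  have hR := contDiffAt_curvatureOf (contDiffAt_christoffelOf hg hinv hd)
    (contDiffAt_christoffelDerivOf hg hinv hd hdd)
  have hRic : ContDiffAt ℝ n (fun x => ricciOf (curvatureOf (christoffelOf (g x) (d x))
      (christoffelDerivOf (g x) (d x) (dd x)))) x :=
    contDiffAt_const.clm_comp (contDiffAt_const.clm_comp (contDiffAt_flip hR))
  exact endTrace.contDiff.contDiffAt.comp x ((contDiffAt_inverse hg hinv).clm_comp hRic)

theorem scalCoord_congr {γ γ' : E → Form E} {y : E} (h : γ =ᶠ[𝓝 y] γ') :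
    scalCoord γ y = scalCoord γ' y := by
  have hΓ (v w : E) : (fun y' => christoffel γ y' v w) =ᶠ[𝓝 y]
      fun y' => christoffel γ' y' v w := by
    filter_upwards [h.eventuallyEq_nhds] with y' hy'
    rw [christoffel, christoffel, hy'.fderiv_eq, hy'.eq_of_nhds]
  have hRic : ricci γ y = ricci γ' y := by
    ext v w
    simp only [ricci, riemann, (hΓ _ _).fderiv_eq, (hΓ _ _).eq_of_nhds]
  rw [scalCoord, scalCoord, hRic, h.eq_of_nhds]

end Curvature

/-! ### Naturality of the curvature -/

section Naturality

variable {E F : Type*} [NormedAddCommGroup E] [NormedSpace ℝ E]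
  [NormedAddCommGroup F] [NormedSpace ℝ F]

/-- The pull-back of a field of bilinear forms by a map between coordinate spaces. -/
def pullForm (φ : E → F) (γ : F → Form F) (y : E) : Form E :=
  (γ (φ y)).bilinearComp (fderiv ℝ φ y) (fderiv ℝ φ y)

theorem pullForm_apply (φ : E → F) (γ : F → Form F) (y v w : E) :
    pullForm φ γ y v w = γ (φ y) (fderiv ℝ φ y v) (fderiv ℝ φ y w) := rfl

variable {φ : E → F} {γ : F → Form F} {y : E}

theorem contDiffAt_pullForm {n m : ℕ∞ω} (hnm : n + 1 ≤ m) (hφ : ContDiffAt ℝ m φ y)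
    (hγ : ContDiffAt ℝ n γ (φ y)) : ContDiffAt ℝ n (pullForm φ γ) y :=
  contDiffAt_bilinearComp (hγ.comp y (hφ.of_le (le_self_add.trans hnm))) (hφ.fderiv_right hnm)
    (hφ.fderiv_right hnm)

theorem fderiv_pullForm (hφ : ContDiffAt ℝ 2 φ y) (hγ : ContDiffAt ℝ 1 γ (φ y)) (u v w : E) :
    fderiv ℝ (pullForm φ γ) y u v w =
      fderiv ℝ γ (φ y) (fderiv ℝ φ y u) (fderiv ℝ φ y v) (fderiv ℝ φ y w)
      + γ (φ y) (fderiv ℝ (fderiv ℝ φ) y u v) (fderiv ℝ φ y w)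
      + γ (φ y) (fderiv ℝ φ y v) (fderiv ℝ (fderiv ℝ φ) y u w) := by
  have hdφ := (hφ.differentiableAt two_ne_zero).hasFDerivAt
  have hddφ := ((hφ.fderiv_right (m := 1) (by norm_num)).differentiableAt one_ne_zero).hasFDerivAt
  have hprod := (((hγ.differentiableAt one_ne_zero).hasFDerivAt.comp y hdφ).clm_apply
    (hddφ.clm_apply (hasFDerivAt_const v y))).clm_apply (hddφ.clm_apply (hasFDerivAt_const w y))
  have hpull := ((contDiffAt_pullForm (by norm_num) hφ hγ).differentiableAt one_ne_zero).hasFDerivAt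
  have key := DFunLike.congr_fun (((hpull.clm_apply (hasFDerivAt_const v y)).clm_apply
    (hasFDerivAt_const w y)).unique hprod) u
  simp only [ContinuousLinearMap.comp_zero, zero_add, ContinuousLinearMap.flip_apply,
    Function.comp_apply, ContinuousLinearMap.flip_add, add_apply,
    ContinuousLinearMap.comp_apply] at key
  rw [key]
  ring

theorem fderiv_christoffel_pullForm (hφ : ContDiffAt ℝ 2 φ y) (hA : (fderiv ℝ φ y).IsInvertible)
    (hγ : ContDiffAt ℝ 1 γ (φ y)) (hsymm : ∀ v w, γ (φ y) v w = γ (φ y) w v)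
    (hinv : (γ (φ y)).IsInvertible) (v w : E) :
    fderiv ℝ φ y (christoffel (pullForm φ γ) y v w) =
      fderiv ℝ (fderiv ℝ φ) y v w + christoffel γ (φ y) (fderiv ℝ φ y v) (fderiv ℝ φ y w) := by
  refine hinv.injective (ContinuousLinearMap.ext fun z' => ?_)
  obtain ⟨z, rfl⟩ := hA.surjective z'
  rw [← pullForm_apply, apply_christoffel (γ := pullForm φ γ) (isInvertible_bilinearComp hinv hA),
    map_add, add_apply, apply_christoffel hinv]
  simp only [fderiv_pullForm hφ hγ]
  have hsymm₂ (a b : E) : fderiv ℝ (fderiv ℝ φ) y a b = fderiv ℝ (fderiv ℝ φ) y b a :=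
    (hφ.isSymmSndFDerivAt (by simp)).eq a b
  rw [hsymm₂ w v, hsymm₂ z v, hsymm₂ z w, hsymm (fderiv ℝ (fderiv ℝ φ) y v z),
    hsymm (fderiv ℝ φ y v) (fderiv ℝ (fderiv ℝ φ) y w z)]
  ring

section Complete

variable [CompleteSpace E] [CompleteSpace F]

theorem eventually_fderiv_christoffel_pullForm (hφ : ContDiffAt ℝ 2 φ y)
    (hA : (fderiv ℝ φ y).IsInvertible) (hγ : ContDiffAt ℝ 1 γ (φ y))
    (hsymm : ∀ᶠ x in 𝓝 (φ y), ∀ v w, γ x v w = γ x w v)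
    (hinv : (γ (φ y)).IsInvertible) (v w : E) :
    (fun y' => fderiv ℝ φ y' (christoffel (pullForm φ γ) y' v w)) =ᶠ[𝓝 y]
      fun y' => fderiv ℝ (fderiv ℝ φ) y' v w +
        christoffel γ (φ y') (fderiv ℝ φ y' v) (fderiv ℝ φ y' w) := by
  have hdφ : ContDiffAt ℝ 1 (fderiv ℝ φ) y := hφ.fderiv_right (by norm_num)
  filter_upwards [hφ.eventually (by simp), eventually_isInvertible hdφ.continuousAt hA,
    hφ.continuousAt (hγ.eventually (by simp)), hφ.continuousAt hsymm,
    hφ.continuousAt (eventually_isInvertible hγ.continuousAt hinv)] with y' hφ' hA' hγ' hsymm' hinv'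
  exact fderiv_christoffel_pullForm hφ' hA' hγ' hsymm' hinv' v w

theorem fderiv_fderiv_christoffel_pullForm (hφ : ContDiffAt ℝ 3 φ y)
    (hA : (fderiv ℝ φ y).IsInvertible) (hγ : ContDiffAt ℝ 2 γ (φ y))
    (hsymm : ∀ᶠ x in 𝓝 (φ y), ∀ v w, γ x v w = γ x w v)
    (hinv : (γ (φ y)).IsInvertible) (u v w : E) :
    fderiv ℝ φ y (fderiv ℝ (fun y' => christoffel (pullForm φ γ) y' v w) y u) =
      fderiv ℝ (fderiv ℝ (fderiv ℝ φ)) y u v w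
      + fderiv ℝ (fun x => christoffel γ x (fderiv ℝ φ y v) (fderiv ℝ φ y w)) (φ y)
          (fderiv ℝ φ y u)
      + christoffel γ (φ y) (fderiv ℝ (fderiv ℝ φ) y u v) (fderiv ℝ φ y w)
      + christoffel γ (φ y) (fderiv ℝ φ y v) (fderiv ℝ (fderiv ℝ φ) y u w)
      - fderiv ℝ (fderiv ℝ φ) y u (christoffel (pullForm φ γ) y v w) := by
  have hφ₂ : ContDiffAt ℝ 2 φ y := hφ.of_le (by norm_num)
  have hdφ : ContDiffAt ℝ 2 (fderiv ℝ φ) y := hφ.fderiv_right (by norm_num)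
  have hddφ : ContDiffAt ℝ 1 (fderiv ℝ (fderiv ℝ φ)) y := hdφ.fderiv_right (by norm_num)
  have hφ' := (hφ.differentiableAt three_ne_zero).hasFDerivAt
  have hdφ' := (hdφ.differentiableAt two_ne_zero).hasFDerivAt
  have hddφ' := (hddφ.differentiableAt one_ne_zero).hasFDerivAt
  have hΓ := hasFDerivAt_christoffelOf hγ hinv
  have hΓ' := hasFDerivAt_christoffelOf (γ := pullForm φ γ)
    (contDiffAt_pullForm (by norm_num) hφ hγ) (isInvertible_bilinearComp hinv hA)
  have hl := hdφ'.clm_apply ((hΓ'.clm_apply (hasFDerivAt_const v y)).clm_apply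
    (hasFDerivAt_const w y))
  have hr := ((hddφ'.clm_apply (hasFDerivAt_const v y)).clm_apply (hasFDerivAt_const w y)).add
    (((hΓ.comp y hφ').clm_apply (hdφ'.clm_apply (hasFDerivAt_const v y))).clm_apply
      (hdφ'.clm_apply (hasFDerivAt_const w y)))
  have law := eventually_fderiv_christoffel_pullForm hφ₂ hA (hγ.of_le one_le_two) hsymm hinv v w
  simp only [christoffel_eq] at law ⊢
  have key := DFunLike.congr_fun ((hl.congr_of_eventuallyEq law.symm).unique hr) u
  have hΓd (v w : F) := (hΓ.clm_apply (hasFDerivAt_const v (φ y))).clm_apply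
    (hasFDerivAt_const w (φ y))
  have hΓd' := (hΓ'.clm_apply (hasFDerivAt_const v y)).clm_apply (hasFDerivAt_const w y)
  rw [(hΓd _ _).fderiv, hΓd'.fderiv, eq_sub_iff_add_eq']
  simp only [ContinuousLinearMap.comp_zero, zero_add, add_apply, ContinuousLinearMap.comp_apply,
    ContinuousLinearMap.flip_apply, Function.comp_apply, ContinuousLinearMap.flip_add] at key ⊢
  rw [add_comm, key]
  abel

theorem fderiv_riemann_pullForm (hφ : ContDiffAt ℝ 3 φ y) (hA : (fderiv ℝ φ y).IsInvertible)
    (hγ : ContDiffAt ℝ 2 γ (φ y)) (hsymm : ∀ᶠ x in 𝓝 (φ y), ∀ v w, γ x v w = γ x w v)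
    (hinv : (γ (φ y)).IsInvertible) (u v w : E) :
    fderiv ℝ φ y (riemann (pullForm φ γ) y u v w) =
      riemann γ (φ y) (fderiv ℝ φ y u) (fderiv ℝ φ y v) (fderiv ℝ φ y w) := by
  have hφ₂ : ContDiffAt ℝ 2 φ y := hφ.of_le (by norm_num)
  have hdφ : ContDiffAt ℝ 2 (fderiv ℝ φ) y := hφ.fderiv_right (by norm_num)
  have hsymm₃ : fderiv ℝ (fderiv ℝ (fderiv ℝ φ)) y u v = fderiv ℝ (fderiv ℝ (fderiv ℝ φ)) y v u :=
    (hdφ.isSymmSndFDerivAt (by simp)).eq u v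
  have hsymm₂ : fderiv ℝ (fderiv ℝ φ) y u v = fderiv ℝ (fderiv ℝ φ) y v u :=
    (hφ₂.isSymmSndFDerivAt (by simp)).eq u v
  have law (v w : E) := fderiv_christoffel_pullForm hφ₂ hA (hγ.of_le one_le_two)
    hsymm.self_of_nhds hinv v w
  simp only [riemann, map_add, map_sub, law, hsymm₃, hsymm₂,
    fderiv_fderiv_christoffel_pullForm hφ hA hγ hsymm hinv]
  simp only [christoffel_eq, map_add]
  abel

end Complete

variable [FiniteDimensional ℝ E] [FiniteDimensional ℝ F]

theorem ricci_pullForm (hφ : ContDiffAt ℝ 3 φ y) (hA : (fderiv ℝ φ y).IsInvertible)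
    (hγ : ContDiffAt ℝ 2 γ (φ y)) (hsymm : ∀ᶠ x in 𝓝 (φ y), ∀ v w, γ x v w = γ x w v)
    (hinv : (γ (φ y)).IsInvertible) (v w : E) :
    ricci (pullForm φ γ) y v w = ricci γ (φ y) (fderiv ℝ φ y v) (fderiv ℝ φ y w) := by
  have hp : ContDiffAt ℝ 2 (pullForm φ γ) y := contDiffAt_pullForm (by norm_num) hφ hγ
  have hpi : (pullForm φ γ y).IsInvertible := isInvertible_bilinearComp hinv hA
  have hR (u : E) := fderiv_riemann_pullForm hφ hA hγ hsymm hinv u v w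
  simp only [riemann_eq hp hpi, riemann_eq hγ hinv] at hR
  rw [ricci_eq hp hpi, ricci_eq hγ hinv, ricciOf_apply, ricciOf_apply]
  obtain ⟨a, ha⟩ := hA
  exact endTrace_eq_of_semiconj a fun u => by simpa [← ha] using hR u

theorem scalCoord_pullForm (hφ : ContDiffAt ℝ 3 φ y) (hA : (fderiv ℝ φ y).IsInvertible)
    (hγ : ContDiffAt ℝ 2 γ (φ y)) (hsymm : ∀ᶠ x in 𝓝 (φ y), ∀ v w, γ x v w = γ x w v)
    (hinv : (γ (φ y)).IsInvertible) : scalCoord (pullForm φ γ) y = scalCoord γ (φ y) := by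
  have hRic : ricci (pullForm φ γ) y =
      fun v w => ricci γ (φ y) (fderiv ℝ φ y v) (fderiv ℝ φ y w) :=
    funext fun v => funext fun w => ricci_pullForm hφ hA hγ hsymm hinv v w
  obtain ⟨a, ha⟩ := hA
  rw [scalCoord, scalCoord, hRic, pullForm, ← ha,
    show ricci γ (φ y) = _ from funext fun v => funext fun w => ricci_eq hγ hinv v w]
  exact metricTrace_bilinearComp a hinv _

end Naturality

/-! ### Curvature under a change of the second normal derivative -/

section NormalPerturbation

variable {E : Type*} [NormedAddCommGroup E] [NormedSpace ℝ E]

theorem christoffelDerivOf_add (g : Form E) (d : E →L[ℝ] Form E)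
    (dd ee : E →L[ℝ] E →L[ℝ] Form E) (u v w : E) :
    christoffelDerivOf g d (dd + ee) u v w =
      christoffelDerivOf g d dd u v w + g.inverse (lowerChristoffel (ee u) v w) := by
  simp only [christoffelDerivOf_apply, add_apply, map_add, map_sub]
  abel

variable {g β : Form E} {τ : E →L[ℝ] ℝ} {e : E} {c : ℝ} {ee : E →L[ℝ] E →L[ℝ] Form E}

theorem lowerChristoffel_of_eq_smul (hee : ∀ u v, ee u v = (c * (τ u * τ v)) • β) (u v w : E) :
    lowerChristoffel (ee u) v w = (c / 2 * τ u) • (τ v • β w + τ w • β v - β v w • τ) := by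
  ext z
  simp only [lowerChristoffel_apply, hee, smul_apply, smul_eq_mul, add_apply, sub_apply]
  ring

theorem curvatureOf_add_of_eq_smul (hge : g.inverse τ = e)
    (hee : ∀ u v, ee u v = (c * (τ u * τ v)) • β) (Γ : E →L[ℝ] E →L[ℝ] E)
    (d : E →L[ℝ] Form E) (dd : E →L[ℝ] E →L[ℝ] Form E) (u v w : E) :
    curvatureOf Γ (christoffelDerivOf g d (dd + ee)) u v w =
      curvatureOf Γ (christoffelDerivOf g d dd) u v w
      + (c / 2) • (τ u • (τ w • g.inverse (β v) - β v w • e)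
        - (τ v * τ w) • g.inverse (β u) + (τ v * β u w) • e) := by
  simp only [curvatureOf_apply, christoffelDerivOf_add, lowerChristoffel_of_eq_smul hee, map_smul,
    map_add, map_sub, hge]
  module

variable [FiniteDimensional ℝ E]

theorem ricciOf_add_of_eq_smul (hge : g.inverse τ = e) (hτ : τ e = 1)
    (hτβ : ∀ v, τ (g.inverse (β v)) = 0) (hβ : ∀ v, β e v = 0)
    (hee : ∀ u v, ee u v = (c * (τ u * τ v)) • β) (Γ : E →L[ℝ] E →L[ℝ] E)
    (d : E →L[ℝ] Form E) (dd : E →L[ℝ] E →L[ℝ] Form E) :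
    ricciOf (curvatureOf Γ (christoffelDerivOf g d (dd + ee))) =
      ricciOf (curvatureOf Γ (christoffelDerivOf g d dd))
      - (c / 2) • (β + endTrace (g.inverse ∘L β) • τ.smulRight τ) := by
  ext v w
  have hR : ((curvatureOf Γ (christoffelDerivOf g d (dd + ee))).flip v).flip w =
      ((curvatureOf Γ (christoffelDerivOf g d dd)).flip v).flip w
      + (c / 2) • (τ.smulRight (τ w • g.inverse (β v) - β v w • e)
        - (τ v * τ w) • (g.inverse ∘L β) + τ v • (β.flip w).smulRight e) := by
    ext u
    simp only [ContinuousLinearMap.flip_apply, curvatureOf_add_of_eq_smul hge hee, add_apply,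
      smul_apply, sub_apply, ContinuousLinearMap.smulRight_apply, ContinuousLinearMap.comp_apply,
      mul_smul]
  simp only [ricciOf_apply, hR, map_add, map_sub, map_smul, endTrace_smulRight, hτβ, hτ, hβ,
    ContinuousLinearMap.flip_apply, sub_apply, smul_apply, add_apply,
    ContinuousLinearMap.smulRight_apply, smul_eq_mul]
  ring

theorem scalOf_add_of_eq_smul (hinv : g.IsInvertible) (hsymm : ∀ v w, g v w = g w v)
    (hge : g e = τ) (hτ : τ e = 1) (hβ : ∀ v, β v e = 0) (hβ' : ∀ v, β e v = 0)
    (hee : ∀ u v, ee u v = (c * (τ u * τ v)) • β) (d : E →L[ℝ] Form E)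
    (dd : E →L[ℝ] E →L[ℝ] Form E) :
    scalOf g d (dd + ee) = scalOf g d dd - c * metricTrace g (fun v w => β v w) := by
  have hge' : g.inverse τ = e := by rw [← hge, hinv.inverse_apply_self]
  have hτβ (v : E) : τ (g.inverse (β v)) = 0 := by
    rw [← hge, hsymm, hinv.self_apply_inverse, hβ]
  have hττ : g.inverse ∘L τ.smulRight τ = τ.smulRight e := by
    ext v
    simp [hge']
  rw [scalOf, scalOf, ricciOf_add_of_eq_smul hge' hτ hτβ hβ' hee, metricTrace_eq_endTrace]
  simp only [ContinuousLinearMap.comp_sub, ContinuousLinearMap.comp_smul,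
    ContinuousLinearMap.comp_add, map_sub, map_add, map_smul, hττ, endTrace_smulRight, hτ,
    smul_eq_mul]
  ring

end NormalPerturbation

/-! ### Warping the normal variable -/

section Warp

variable {E : Type*} [NormedAddCommGroup E] [NormedSpace ℝ E]

variable (E) in
/-- The linear map `(b, v) ↦ (a b, v)`, the differential of `(t, y) ↦ (h t, y)` if `a = h' t`. -/
def stretch (a : ℝ) : ℝ × E →L[ℝ] ℝ × E :=
  (ContinuousLinearMap.inr ℝ ℝ E).comp (ContinuousLinearMap.snd ℝ ℝ E) +
    a • (ContinuousLinearMap.inl ℝ ℝ E).comp (ContinuousLinearMap.fst ℝ ℝ E)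

theorem stretch_apply (a : ℝ) (v : ℝ × E) : stretch E a v = (a * v.1, v.2) := by
  simp [stretch]

theorem stretch_one : stretch E 1 = ContinuousLinearMap.id ℝ (ℝ × E) := by
  ext v <;> simp [stretch]

theorem contDiff_stretch {n : ℕ∞ω} : ContDiff ℝ n (stretch E) :=
  contDiff_const.add (contDiff_id.smul contDiff_const)

theorem hasFDerivAt_warp {h : ℝ → ℝ} {z : ℝ × E} (hh : DifferentiableAt ℝ h z.1) :
    HasFDerivAt (fun z : ℝ × E => (h z.1, z.2)) (stretch E (deriv h z.1)) z := by
  have hfst : HasFDerivAt (fun z : ℝ × E => h z.1)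
      (deriv h z.1 • ContinuousLinearMap.fst ℝ ℝ E) z :=
    hh.hasDerivAt.comp_hasFDerivAt z (hasFDerivAt_fst (p := z))
  have hstretch : stretch E (deriv h z.1) =
      (deriv h z.1 • ContinuousLinearMap.fst ℝ ℝ E).prod (ContinuousLinearMap.snd ℝ ℝ E) := by
    ext v <;> simp [stretch_apply]
  rw [hstretch]
  exact hfst.prodMk hasFDerivAt_snd

section Derivatives

variable {V : Type*} [NormedAddCommGroup V] [NormedSpace ℝ V]
  {h : ℝ → ℝ} {z : ℝ × E} {G : ℝ × E → V}

theorem fderiv_warp (hh : DifferentiableAt ℝ h z.1) (hG : DifferentiableAt ℝ G (h z.1, z.2)) :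
    fderiv ℝ (fun z : ℝ × E => G (h z.1, z.2)) z =
      (fderiv ℝ G (h z.1, z.2)).comp (stretch E (deriv h z.1)) :=
  (hG.hasFDerivAt.comp z (hasFDerivAt_warp hh)).fderiv

theorem hasFDerivAt_stretch_deriv (hh : ContDiffAt ℝ 2 h z.1) :
    HasFDerivAt (fun z : ℝ × E => stretch E (deriv h z.1))
      ((deriv (deriv h) z.1 • ContinuousLinearMap.fst ℝ ℝ E).smulRight
        ((ContinuousLinearMap.inl ℝ ℝ E).comp (ContinuousLinearMap.fst ℝ ℝ E))) z := by
  have hdh : ContDiffAt ℝ 1 (deriv h) z.1 := hh.derivWithin (by norm_num)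
  exact (((hdh.differentiableAt one_ne_zero).hasDerivAt.comp_hasFDerivAt z
    (hasFDerivAt_fst (p := z))).smul_const _).const_add _

theorem fderiv_fderiv_warp (hh : ContDiffAt ℝ 2 h z.1) (hG : ContDiffAt ℝ 2 G (h z.1, z.2))
    (u v : ℝ × E) :
    fderiv ℝ (fderiv ℝ (fun z : ℝ × E => G (h z.1, z.2))) z u v =
      (fderiv ℝ (fderiv ℝ G) (h z.1, z.2)).bilinearComp (stretch E (deriv h z.1))
        (stretch E (deriv h z.1)) u v +
      (deriv (deriv h) z.1 * (u.1 * v.1)) • fderiv ℝ G (h z.1, z.2) (1, 0) := by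
  have hwarp := hasFDerivAt_warp (E := E) (hh.differentiableAt two_ne_zero)
  have hfderiv : fderiv ℝ (fun z : ℝ × E => G (h z.1, z.2)) =ᶠ[𝓝 z] fun z =>
      (fderiv ℝ G (h z.1, z.2)).comp (stretch E (deriv h z.1)) := by
    have hh_ev : ∀ᶠ z' in 𝓝 z, ContDiffAt ℝ 2 h z'.1 :=
      continuousAt_fst (hh.eventually (by simp))
    have hG_ev : ∀ᶠ z' in 𝓝 z, ContDiffAt ℝ 2 G (h z'.1, z'.2) :=
      hwarp.continuousAt (hG.eventually (by simp))
    filter_upwards [hh_ev, hG_ev] with z' hh' hG'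
    exact fderiv_warp (hh'.differentiableAt two_ne_zero) (hG'.differentiableAt two_ne_zero)
  have hddG := ((hG.fderiv_right (m := 1) (by norm_num)).differentiableAt
    one_ne_zero).hasFDerivAt.comp z hwarp
  have hinl : (v.1, (0 : E)) = v.1 • ((1 : ℝ), (0 : E)) := by simp
  rw [hfderiv.fderiv_eq]
  refine (DFunLike.congr_fun (DFunLike.congr_fun
    (hddG.clm_comp (hasFDerivAt_stretch_deriv hh)).fderiv u) v).trans ?_
  simp only [add_apply, ContinuousLinearMap.comp_apply, ContinuousLinearMap.compL_apply,
    ContinuousLinearMap.flip_apply, ContinuousLinearMap.smulRight_apply, smul_apply,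
    ContinuousLinearMap.coe_fst', ContinuousLinearMap.bilinearComp_apply, smul_eq_mul,
    ContinuousLinearMap.inl_apply, hinl, map_smul, smul_smul, Function.comp_apply]
  rw [add_comm, mul_assoc]

end Derivatives

/-- A scalar product on `ℝ × E` of the form `dt² + g_t`. -/
structure IsFermiForm (b : Form (ℝ × E)) : Prop where
  symm : ∀ v w, b v w = b w v
  pos : ∀ v, v ≠ 0 → 0 < b v v
  apply_dt : ∀ v, b (1, 0) v = v.1

variable {G : ℝ × E → Form (ℝ × E)} {z : ℝ × E}

theorem IsFermiForm.fderiv_apply_dt (hF : ∀ᶠ z' in 𝓝 z, IsFermiForm (G z'))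
    (hG : DifferentiableAt ℝ G z) (u v : ℝ × E) : fderiv ℝ G z u (1, 0) v = 0 := by
  have hd := (hG.hasFDerivAt.clm_apply (hasFDerivAt_const (1, 0) z)).clm_apply
    (hasFDerivAt_const v z)
  have hconst : (fun z => G z (1, 0) v) =ᶠ[𝓝 z] fun _ => v.1 := hF.mono fun z' hz' => hz'.apply_dt v
  simpa using DFunLike.congr_fun
    (hd.unique ((hasFDerivAt_const v.1 z).congr_of_eventuallyEq hconst)) u

theorem fderiv_apply_symm {F : Type*} [NormedAddCommGroup F] [NormedSpace ℝ F] {γ : F → Form F}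
    {y : F} (hγ : DifferentiableAt ℝ γ y) (hsymm : ∀ᶠ x in 𝓝 y, ∀ v w, γ x v w = γ x w v)
    (u v w : F) : fderiv ℝ γ y u v w = fderiv ℝ γ y u w v := by
  have hd (v w : F) := (hγ.hasFDerivAt.clm_apply (hasFDerivAt_const v y)).clm_apply
    (hasFDerivAt_const w y)
  have heq : (fun x => γ x v w) =ᶠ[𝓝 y] fun x => γ x w v := hsymm.mono fun x hx => hx v w
  simpa using DFunLike.congr_fun ((hd v w).unique ((hd w v).congr_of_eventuallyEq heq)) u

variable [FiniteDimensional ℝ E]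

/-- The trace of `∂_t g_t` for a metric `dt² + g_t`; it is `-2` times the mean curvature of the
slice with respect to `∂_t`. -/
def normalTrace (G : ℝ × E → Form (ℝ × E)) (z : ℝ × E) : ℝ :=
  metricTrace (G z) (fun v w => fderiv ℝ G z (1, 0) v w)

theorem continuousAt_normalTrace (hG : ContDiffAt ℝ 1 G z) (hinv : (G z).IsInvertible) :
    ContinuousAt (normalTrace G) z := by
  have hdG : ContinuousAt (fderiv ℝ G) z := (hG.fderiv_right (m := 0) (by simp)).continuousAt
  have hnormalTrace : normalTrace G =
      fun z => endTrace ((G z).inverse.comp (fderiv ℝ G z (1, 0))) :=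
    funext fun z => metricTrace_eq_endTrace (G z) (fderiv ℝ G z (1, 0))
  rw [hnormalTrace]
  exact endTrace.continuous.continuousAt.comp
    ((contDiffAt_inverse (n := 1) hG hinv).continuousAt.clm_comp (hdG.clm_apply continuousAt_const))

/-- The scalar curvature at `τ = 0` of the metric `G (s + a τ, y)`, where `q = ((s, y), a)`. -/
def scalWarp (G : ℝ × E → Form (ℝ × E)) (q : (ℝ × E) × ℝ) : ℝ :=
  scalOf (G q.1) ((fderiv ℝ G q.1).comp (stretch E q.2))
    ((fderiv ℝ (fderiv ℝ G) q.1).bilinearComp (stretch E q.2) (stretch E q.2))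

theorem contDiffAt_scalWarp {q : (ℝ × E) × ℝ} (hG : ContDiffAt ℝ 3 G q.1)
    (hinv : (G q.1).IsInvertible) : ContDiffAt ℝ 1 (scalWarp G) q := by
  have hstretch : ContDiffAt ℝ 1 (fun q : (ℝ × E) × ℝ => stretch E q.2) q :=
    (contDiff_stretch (E := E)).contDiffAt.comp q contDiffAt_snd
  have hdG : ContDiffAt ℝ 2 (fderiv ℝ G) q.1 := hG.fderiv_right (by norm_num)
  have hddG : ContDiffAt ℝ 1 (fderiv ℝ (fderiv ℝ G)) q.1 := hdG.fderiv_right (by norm_num)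
  exact contDiffAt_scalOf ((hG.of_le (by norm_num)).comp q contDiffAt_fst) hinv
    (((hdG.of_le one_le_two).comp q contDiffAt_fst).clm_comp hstretch)
    (contDiffAt_bilinearComp (hddG.comp q contDiffAt_fst) hstretch hstretch)

theorem scalWarp_one (hG : ContDiffAt ℝ 2 G z) (hinv : (G z).IsInvertible) :
    scalWarp G (z, 1) = scalCoord G z := by
  rw [scalCoord_eq_scalOf hG hinv, scalWarp, stretch_one]
  rfl

theorem scalCoord_warp {h : ℝ → ℝ} (hh : ContDiffAt ℝ 2 h z.1)
    (hG : ContDiffAt ℝ 2 G (h z.1, z.2)) (hF : ∀ᶠ z' in 𝓝 (h z.1, z.2), IsFermiForm (G z')) :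
    scalCoord (fun z : ℝ × E => G (h z.1, z.2)) z =
      scalWarp G ((h z.1, z.2), deriv h z.1) -
        deriv (deriv h) z.1 * normalTrace G (h z.1, z.2) := by
  have hform := hF.self_of_nhds
  have hinv := isInvertible_of_posDef hform.pos
  have hdG := hG.differentiableAt two_ne_zero
  have hGwarp : ContDiffAt ℝ 2 (fun z : ℝ × E => G (h z.1, z.2)) z :=
    hG.comp z ((hh.comp z contDiffAt_fst).prodMk contDiffAt_snd)
  let τ : ℝ × E →L[ℝ] ℝ := ContinuousLinearMap.fst ℝ ℝ E
  let ee : ℝ × E →L[ℝ] ℝ × E →L[ℝ] Form (ℝ × E) :=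
    deriv (deriv h) z.1 • τ.smulRight (τ.smulRight (fderiv ℝ G (h z.1, z.2) (1, 0)))
  have hee (u v : ℝ × E) : ee u v =
      (deriv (deriv h) z.1 * (τ u * τ v)) • fderiv ℝ G (h z.1, z.2) (1, 0) := by
    simp only [ee, smul_apply, ContinuousLinearMap.smulRight_apply]
    module
  have hjet : fderiv ℝ (fderiv ℝ (fun z : ℝ × E => G (h z.1, z.2))) z =
      (fderiv ℝ (fderiv ℝ G) (h z.1, z.2)).bilinearComp (stretch E (deriv h z.1))
        (stretch E (deriv h z.1)) + ee :=
    ContinuousLinearMap.ext fun u => ContinuousLinearMap.ext fun v => by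
      rw [fderiv_fderiv_warp hh hG, add_apply, add_apply, hee]
      rfl
  have hβ := IsFermiForm.fderiv_apply_dt hF hdG (1, 0)
  have hβ' (v : ℝ × E) : fderiv ℝ G (h z.1, z.2) (1, 0) v (1, 0) = 0 :=
    (fderiv_apply_symm hdG (hF.mono fun _ hz => hz.symm) _ _ _).trans (hβ v)
  rw [scalCoord_eq_scalOf hGwarp hinv, hjet, fderiv_warp (hh.differentiableAt two_ne_zero) hdG]
  exact scalOf_add_of_eq_smul hinv hform.symm (ContinuousLinearMap.ext hform.apply_dt)
    (τ := τ) (e := (1, 0)) rfl hβ' hβ hee _ _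

end Warp

section Compression

variable {k δ : ℝ} {h : ℝ → ℝ} {t : ℝ}

theorem IsCompression.differentiable (H : IsCompression k δ h) : Differentiable ℝ h :=
  H.smooth.differentiable (by simp)

theorem IsCompression.monotone_deriv (H : IsCompression k δ h) : Monotone (deriv h) :=
  monotone_of_deriv_nonneg ((contDiff_infty_iff_deriv.1 H.smooth).2.differentiable (by simp))
    H.convex

theorem IsCompression.deriv_zero (H : IsCompression k δ h) : deriv h 0 = 0 := by
  have hneg := deriv_comp_neg h 0
  rw [show (fun t => h (-t)) = h from funext H.even, neg_zero] at hneg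
  linarith

theorem IsCompression.deriv_nonneg (H : IsCompression k δ h) (ht : 0 ≤ t) : 0 ≤ deriv h t :=
  H.deriv_zero ▸ H.monotone_deriv ht

theorem IsCompression.deriv_le_one (H : IsCompression k δ h) (t : ℝ) : deriv h t ≤ 1 :=
  (abs_le.1 (H.abs_deriv_le t)).2

theorem IsCompression.self_le (H : IsCompression k δ h) (ht : t ≤ δ) : t ≤ h t := by
  have hmv : h δ - h t ≤ 1 * (δ - t) :=
    image_sub_le_mul_sub_of_deriv_le H.differentiable H.deriv_le_one ht
  rw [H.right δ le_rfl] at hmv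
  linarith

theorem IsCompression.deriv_mul_sub_le (H : IsCompression k δ h) (ht : t ≤ δ) :
    deriv h t * (δ - t) ≤ δ - h t := by
  have hmv : deriv h t * (δ - t) ≤ h δ - h t :=
    (convex_Icc t δ).mul_sub_le_image_sub_of_le_deriv H.differentiable.continuous.continuousOn
      H.differentiable.differentiableOn
      (fun x hx => H.monotone_deriv (by rw [interior_Icc] at hx; exact hx.1.le))
      t ⟨le_rfl, ht⟩ δ ⟨ht, le_rfl⟩ ht
  rwa [H.right δ le_rfl] at hmv

theorem IsCompression.le_delta (H : IsCompression k δ h) (ht : t ∈ Set.Icc 0 δ) : h t ≤ δ := by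
  nlinarith [H.deriv_mul_sub_le ht.2, mul_nonneg (H.deriv_nonneg ht.1) (sub_nonneg.2 ht.2)]

theorem IsCompression.sub_self_le (H : IsCompression k δ h) (ht : t ∈ Set.Icc 0 δ) :
    h t - t ≤ δ * (1 - deriv h t) := by
  nlinarith [H.deriv_mul_sub_le ht.2, mul_nonneg ht.1 (sub_nonneg.2 (H.deriv_le_one t))]

theorem IsCompression.mul_le_deriv_deriv (H : IsCompression k δ h) (ht : 0 ≤ t) :
    k * (1 - deriv h t) ≤ deriv (deriv h) t := by
  have hgrowth := H.growth_right t ht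
  rwa [abs_of_nonneg (H.convex t), abs_sub_comm,
    abs_of_nonneg (sub_nonneg.2 (H.deriv_le_one t))] at hgrowth

end Compression

section LocalEstimate

variable {E : Type*} [NormedAddCommGroup E] [NormedSpace ℝ E] [FiniteDimensional ℝ E]
  {G : ℝ × E → Form (ℝ × E)}

/- The warp changes `scalWarp` by at most `L (1 - h')`, because `h t - t ≤ δ (1 - h')`, while the
term with `h''` contributes at least `c k (1 - h')`. -/
theorem scalCoord_le_warp_of_lipschitzOnWith {c k δ t : ℝ} {L : NNReal} {y : E} {h : ℝ → ℝ}
    (H : IsCompression k δ h) (hδ : δ ≤ 1) (hc : 0 ≤ c) (hk : L ≤ k * c)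
    (hG : ∀ s ∈ Set.Icc 0 δ, ContDiffAt ℝ 2 G (s, y))
    (hF : ∀ s ∈ Set.Icc 0 δ, ∀ᶠ z in 𝓝 (s, y), IsFermiForm (G z))
    (hmean : ∀ s ∈ Set.Icc 0 δ, normalTrace G (s, y) ≤ -c)
    (hL : LipschitzOnWith L (scalWarp G) ((Set.Icc 0 δ ×ˢ {y}) ×ˢ Set.Icc 0 1))
    (ht : t ∈ Set.Icc 0 δ) :
    scalCoord G (t, y) ≤ scalCoord (fun z : ℝ × E => G (h z.1, z.2)) (t, y) := by
  have hht : h t ∈ Set.Icc 0 δ := ⟨ht.1.trans (H.self_le ht.2), H.le_delta ht⟩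
  have hd : 0 ≤ 1 - deriv h t := sub_nonneg.2 (H.deriv_le_one t)
  have hdist : dist (((t, y), 1) : (ℝ × E) × ℝ) ((h t, y), deriv h t) ≤ 1 - deriv h t := by
    rw [Prod.dist_eq, Prod.dist_eq, dist_self, Real.dist_eq, Real.dist_eq, abs_sub_comm,
      abs_of_nonneg (sub_nonneg.2 (H.self_le ht.2)), abs_of_nonneg hd]
    refine max_le (max_le ?_ hd) le_rfl
    exact (H.sub_self_le ht).trans (mul_le_of_le_one_left hd hδ)
  have hlip := hL.dist_le_mul ((t, y), 1) ⟨⟨ht, rfl⟩, by simp⟩ ((h t, y), deriv h t)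
    ⟨⟨hht, rfl⟩, H.deriv_nonneg ht.1, H.deriv_le_one t⟩
  have hwarp : scalWarp G ((t, y), 1) - scalWarp G ((h t, y), deriv h t) ≤
      k * c * (1 - deriv h t) :=
    calc _ ≤ L * (1 - deriv h t) :=
          (le_abs_self _).trans (hlip.trans (mul_le_mul_of_nonneg_left hdist L.2))
      _ ≤ k * c * (1 - deriv h t) := mul_le_mul_of_nonneg_right hk hd
  have hbend : k * c * (1 - deriv h t) ≤ -(deriv (deriv h) t * normalTrace G (h t, y)) :=
    calc k * c * (1 - deriv h t) = k * (1 - deriv h t) * c := by ring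
      _ ≤ deriv (deriv h) t * c := mul_le_mul_of_nonneg_right (H.mul_le_deriv_deriv ht.1) hc
      _ ≤ -(deriv (deriv h) t * normalTrace G (h t, y)) := by
          nlinarith [mul_le_mul_of_nonneg_left (hmean _ hht) (H.convex t)]
  rw [scalCoord_warp (z := (t, y)) (H.smooth.contDiffAt.of_le ENat.LEInfty.out) (hG _ hht)
    (hF _ hht), ← scalWarp_one (hG t ht) (isInvertible_of_posDef (hF t ht).self_of_nhds.pos)]
  linarith

theorem exists_scalCoord_le_warp {σ : ℝ} (hσ : 0 < σ) {V : Set E} (hV : IsOpen V) {y₀ : E}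
    (hy₀ : y₀ ∈ V) (hG : ∀ z ∈ Set.Ioo (-σ) σ ×ˢ V, ContDiffAt ℝ 3 G z)
    (hF : ∀ z ∈ Set.Ioo (-σ) σ ×ˢ V, IsFermiForm (G z)) (hmean : normalTrace G (0, y₀) < 0) :
    ∃ N ∈ 𝓝 y₀, N ⊆ V ∧ ∃ σ₁ : ℝ, 0 < σ₁ ∧ σ₁ < σ ∧ ∃ k₀ : ℝ, ∀ k δ : ℝ, k₀ ≤ k → δ ≤ σ₁ →
      ∀ h : ℝ → ℝ, IsCompression k δ h → ∀ t ∈ Set.Icc 0 δ, ∀ y ∈ N,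
        scalCoord G (t, y) ≤ scalCoord (fun z : ℝ × E => G (h z.1, z.2)) (t, y) := by
  have hopen : IsOpen (Set.Ioo (-σ) σ ×ˢ V) := isOpen_Ioo.prod hV
  have hmem : ((0 : ℝ), y₀) ∈ Set.Ioo (-σ) σ ×ˢ V := ⟨⟨neg_lt_zero.2 hσ, hσ⟩, hy₀⟩
  have hinv (z) (hz : z ∈ Set.Ioo (-σ) σ ×ˢ V) := isInvertible_of_posDef (hF z hz).pos
  obtain ⟨c, hc₀, hc⟩ : ∃ c : ℝ, 0 < c ∧ normalTrace G (0, y₀) < -c :=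
    ⟨-normalTrace G (0, y₀) / 2, by linarith, by linarith⟩
  have hev : ∀ᶠ z in 𝓝 ((0 : ℝ), y₀), z ∈ Set.Ioo (-σ) σ ×ˢ V ∧ normalTrace G z < -c :=
    (hopen.eventually_mem hmem).and ((continuousAt_normalTrace ((hG _ hmem).of_le (by norm_num))
      (hinv _ hmem)).eventually_lt continuousAt_const hc)
  obtain ⟨ε, hε, hball⟩ := Metric.eventually_nhds_iff_ball.1 hev
  obtain ⟨r, hr₀, hr⟩ := exists_between (lt_min hε one_pos)
  obtain ⟨hrε, hr₁⟩ := lt_min_iff.1 hr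
  have hgood : ∀ s ∈ Set.Icc 0 r, ∀ y ∈ Metric.closedBall y₀ r,
      (s, y) ∈ Set.Ioo (-σ) σ ×ˢ V ∧ normalTrace G (s, y) < -c := by
    intro s hs y hy
    refine hball _ ?_
    rw [Metric.mem_ball, Prod.dist_eq, max_lt_iff, Real.dist_eq, sub_zero, abs_of_nonneg hs.1]
    exact ⟨hs.2.trans_lt hrε, (Metric.mem_closedBall.1 hy).trans_lt hrε⟩
  obtain ⟨L, hL⟩ : ∃ L, LipschitzOnWith L (scalWarp G)
      ((Set.Icc 0 r ×ˢ Metric.closedBall y₀ r) ×ˢ Set.Icc 0 1) := by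
    refine ContDiffOn.exists_lipschitzOnWith (fun q hq => ?_) one_ne_zero
      (((convex_Icc 0 r).prod (convex_closedBall y₀ r)).prod (convex_Icc 0 1))
      ((isCompact_Icc.prod (isCompact_closedBall y₀ r)).prod isCompact_Icc)
    have hq' := (hgood _ hq.1.1 _ hq.1.2).1
    exact (contDiffAt_scalWarp (hG _ hq') (hinv _ hq')).contDiffWithinAt
  refine ⟨Metric.closedBall y₀ r, Metric.closedBall_mem_nhds _ hr₀,
    fun y hy => (hgood 0 ⟨le_rfl, hr₀.le⟩ y hy).1.2, r, hr₀,
    (hgood r ⟨hr₀.le, le_rfl⟩ y₀ (Metric.mem_closedBall_self hr₀.le)).1.1.2, L / c, ?_⟩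
  intro k δ hk hδ h H t ht y hy
  have hsub : Set.Icc 0 δ ⊆ Set.Icc 0 r := Set.Icc_subset_Icc_right hδ
  exact scalCoord_le_warp_of_lipschitzOnWith H (hδ.trans hr₁.le) hc₀.le ((div_le_iff₀ hc₀).1 hk)
    (fun s hs => (hG _ (hgood s (hsub hs) y hy).1).of_le (by norm_num))
    (fun s hs => (hopen.eventually_mem (hgood s (hsub hs) y hy).1).mono hF)
    (fun s hs => (hgood s (hsub hs) y hy).2.le)
    (hL.mono (Set.prod_mono (Set.prod_mono hsub (Set.singleton_subset_iff.2 hy)) le_rfl)) ht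

end LocalEstimate

/-! ### Local parametrizations of a Riemannian manifold -/

local notation "𝔼" n:max => EuclideanSpace ℝ (Fin n)

section Pullback

variable {m : ℕ} {H : Type*} [TopologicalSpace H] [ChartedSpace (𝔼 m) H]
  {E : Type*} [NormedAddCommGroup E] [NormedSpace ℝ E]
  {F : Type*} [NormedAddCommGroup F] [NormedSpace ℝ F]

/-- The derivative of a map `ψ : E → H` from a coordinate space. Its values are tangent vectors of
`H` at `ψ y`, typed here as elements of the model space `𝔼 m`. -/
def paramDeriv (ψ : E → H) (y : E) : E →L[ℝ] 𝔼 m :=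
  mfderiv 𝓘(ℝ, E) (𝓡 m) ψ y

/-- The pull-back by `ψ : E → H` of the field `s` of bilinear forms on the tangent spaces of `H`,
all of them identified with the model space `𝔼 m`. -/
def pullback (s : H → Form (𝔼 m)) (ψ : E → H) (y : E) : Form E :=
  (s (ψ y)).bilinearComp (paramDeriv ψ y) (paramDeriv ψ y)

/-- `ψ` is smooth near `y` and its derivative at `y` is bijective: a local parametrization. -/
structure IsParamAt (ψ : E → H) (y : E) : Prop where
  contMDiffAt : ContMDiffAt 𝓘(ℝ, E) (𝓡 m) ∞ ψ y
  isInvertible : (paramDeriv (m := m) ψ y).IsInvertible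

theorem pullback_apply (s : H → Form (𝔼 m)) (ψ : E → H) (y v w : E) :
    pullback s ψ y v w = s (ψ y) (paramDeriv ψ y v) (paramDeriv ψ y w) := rfl

theorem paramDeriv_comp {ψ : F → H} {φ : E → F} {y : E}
    (hψ : MDifferentiableAt 𝓘(ℝ, F) (𝓡 m) ψ (φ y)) (hφ : DifferentiableAt ℝ φ y) :
    paramDeriv (m := m) (ψ ∘ φ) y = (paramDeriv ψ (φ y)).comp (fderiv ℝ φ y) := by
  rw [← mfderiv_eq_fderiv]
  exact mfderiv_comp y hψ hφ.mdifferentiableAt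

theorem paramDeriv_congr {ψ ψ' : E → H} {y : E} (h : ψ =ᶠ[𝓝 y] ψ') :
    paramDeriv (m := m) ψ y = paramDeriv ψ' y :=
  h.mfderiv_eq

theorem paramDeriv_eq_fderiv_extChartAt_comp {ψ : E → H} {y : E} {x : H} (hx : ψ y = x)
    (hψ : MDifferentiableAt 𝓘(ℝ, E) (𝓡 m) ψ y) :
    paramDeriv ψ y = fderiv ℝ (extChartAt (𝓡 m) x ∘ ψ) y := by
  subst hx
  refine hψ.mfderiv.trans ?_
  simp only [writtenInExtChartAt, extChartAt_model_space_eq_id, PartialEquiv.refl_symm,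
    PartialEquiv.refl_coe, Function.comp_id, modelWithCornersSelf_coe, Set.range_id,
    fderivWithin_univ, id_eq]
  rfl

theorem pullback_comp (s : H → Form (𝔼 m)) {ψ : F → H} {φ : E → F} {y : E}
    (hψ : MDifferentiableAt 𝓘(ℝ, F) (𝓡 m) ψ (φ y)) (hφ : DifferentiableAt ℝ φ y) :
    pullback s (ψ ∘ φ) y = pullForm φ (pullback s ψ) y := by
  ext v w
  simp only [pullback_apply, pullForm_apply, paramDeriv_comp hψ hφ, Function.comp_apply,
    ContinuousLinearMap.comp_apply]

theorem pullback_congr (s : H → Form (𝔼 m)) {ψ ψ' : E → H} {y : E} (h : ψ =ᶠ[𝓝 y] ψ') :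
    pullback s ψ y = pullback s ψ' y := by
  rw [pullback, pullback, paramDeriv_congr h, h.eq_of_nhds]

theorem contDiffAt_extChartAt_comp [IsManifold (𝓡 m) ∞ H] {ψ : E → H} {y : E}
    (hψ : ContMDiffAt 𝓘(ℝ, E) (𝓡 m) ∞ ψ y) :
    ContDiffAt ℝ ∞ (extChartAt (𝓡 m) (ψ y) ∘ ψ) y := by
  rw [← contMDiffAt_iff_contDiffAt]
  exact (contMDiffAt_iff_target.1 hψ).2

theorem eventuallyEq_extChartAt_symm_comp {X : Type*} [TopologicalSpace X] {ψ : X → H} {y : X}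
    (hψ : ContinuousAt ψ y) :
    ψ =ᶠ[𝓝 y] (extChartAt (𝓡 m) (ψ y)).symm ∘ (extChartAt (𝓡 m) (ψ y) ∘ ψ) := by
  filter_upwards [hψ (extChartAt_source_mem_nhds (I := 𝓡 m) (ψ y))] with z hz
  exact ((extChartAt (𝓡 m) (ψ y)).left_inv hz).symm

theorem eventually_differentiableAt {φ : E → F} {y : E} (hφ : ContDiffAt ℝ ∞ φ y) :
    ∀ᶠ z in 𝓝 y, DifferentiableAt ℝ φ z :=
  ((hφ.of_le (m := 1) ENat.LEInfty.out).eventually (by simp)).mono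
    fun _ hz => hz.differentiableAt (by simp)

variable [IsManifold (𝓡 m) ∞ H]

theorem eventually_mdifferentiableAt {ψ : E → H} {y : E}
    (hψ : ContMDiffAt 𝓘(ℝ, E) (𝓡 m) ∞ ψ y) :
    ∀ᶠ z in 𝓝 y, MDifferentiableAt 𝓘(ℝ, E) (𝓡 m) ψ z := by
  have hψ₁ : ContMDiffAt 𝓘(ℝ, E) (𝓡 m) 1 ψ y := hψ.of_le ENat.LEInfty.out
  exact ((contMDiffAt_iff_contMDiffAt_nhds (by simp)).1 hψ₁).mono
    fun z hz => hz.mdifferentiableAt (by simp)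

theorem isParamAt_extChartAt_symm {x : H} {y : 𝔼 m} (hy : y ∈ (extChartAt (𝓡 m) x).target) :
    IsParamAt (m := m) (extChartAt (𝓡 m) x).symm y where
  contMDiffAt := (contMDiffOn_extChartAt_symm x).contMDiffAt (extChartAt_target_mem_nhds' hy)
  isInvertible := by
    have h := isInvertible_mfderivWithin_extChartAt_symm (I := 𝓡 m) hy
    rwa [ModelWithCorners.range_eq_univ, mfderivWithin_univ] at h

theorem paramDeriv_extChartAt_symm_self (x : H) :
    paramDeriv (extChartAt (𝓡 m) x).symm (extChartAt (𝓡 m) x x) =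
      ContinuousLinearMap.id ℝ (𝔼 m) := by
  have h : extChartAt (𝓡 m) x ∘ (extChartAt (𝓡 m) x).symm =ᶠ[𝓝 (extChartAt (𝓡 m) x x)] id :=
    Filter.mem_of_superset (extChartAt_target_mem_nhds (I := 𝓡 m) x)
      fun y hy => (extChartAt (𝓡 m) x).right_inv hy
  rw [paramDeriv_eq_fderiv_extChartAt_comp (extChartAt_to_inv x)
    ((isParamAt_extChartAt_symm (mem_extChartAt_target x)).contMDiffAt.mdifferentiableAt (by simp)),
    h.fderiv_eq, fderiv_id]

theorem pullback_eventuallyEq_pullForm (s : H → Form (𝔼 m)) {ψ' : E → H} {ψ : F → H} {φ : E → F}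
    {y : E} (h : ψ' =ᶠ[𝓝 y] ψ ∘ φ) (hψ : ContMDiffAt 𝓘(ℝ, F) (𝓡 m) ∞ ψ (φ y))
    (hφ : ContDiffAt ℝ ∞ φ y) :
    pullback s ψ' =ᶠ[𝓝 y] pullForm φ (pullback s ψ) := by
  filter_upwards [h.eventuallyEq_nhds, eventually_differentiableAt hφ,
    hφ.continuousAt (eventually_mdifferentiableAt hψ)] with z hz hφz hψz
  rw [pullback_congr s hz, pullback_comp s hψz hφz]

theorem pullback_eventuallyEq (s : H → Form (𝔼 m)) {ψ : E → H} {y : E}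
    (hψ : ContMDiffAt 𝓘(ℝ, E) (𝓡 m) ∞ ψ y) :
    pullback s ψ =ᶠ[𝓝 y] pullForm (extChartAt (𝓡 m) (ψ y) ∘ ψ)
      (pullback s (extChartAt (𝓡 m) (ψ y)).symm) :=
  pullback_eventuallyEq_pullForm s (eventuallyEq_extChartAt_symm_comp hψ.continuousAt)
    (isParamAt_extChartAt_symm (mem_extChartAt_target (ψ y))).contMDiffAt
    (contDiffAt_extChartAt_comp hψ)

theorem IsParamAt.exists_localInverse [CompleteSpace E] {ψ : E → H} {y : E}
    (hψ : IsParamAt (m := m) ψ y) :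
    ∃ θ : 𝔼 m → E, ContDiffAt ℝ ∞ θ (extChartAt (𝓡 m) (ψ y) (ψ y)) ∧
      θ (extChartAt (𝓡 m) (ψ y) (ψ y)) = y ∧
      (extChartAt (𝓡 m) (ψ y)).symm =ᶠ[𝓝 (extChartAt (𝓡 m) (ψ y) (ψ y))] ψ ∘ θ := by
  have hφ := contDiffAt_extChartAt_comp hψ.contMDiffAt
  obtain ⟨A, hA⟩ := hψ.isInvertible
  have hA' : HasFDerivAt (extChartAt (𝓡 m) (ψ y) ∘ ψ) (A : E →L[ℝ] 𝔼 m) y := by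
    rw [hA, paramDeriv_eq_fderiv_extChartAt_comp rfl (hψ.contMDiffAt.mdifferentiableAt (by simp))]
    exact (hφ.differentiableAt (by simp)).hasFDerivAt
  have hθ := hφ.to_localInverse hA' (by simp)
  have hθy := hφ.localInverse_apply_image hA' (by simp)
  have hright := (hφ.hasStrictFDerivAt' hA' (by simp)).eventually_right_inverse
  have hlim := hθ.continuousAt.tendsto
  rw [hθy] at hlim
  have hleft := hlim.eventually
    (eventuallyEq_extChartAt_symm_comp (m := m) hψ.contMDiffAt.continuousAt)
  refine ⟨hφ.localInverse hA' (by simp), hθ, hθy, ?_⟩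
  filter_upwards [hright, hleft] with z hz hz'
  exact (congrArg _ hz.symm).trans hz'.symm

end Pullback

section Metric

variable {m : ℕ} {H : Type*} [TopologicalSpace H] [ChartedSpace (𝔼 m) H] [IsManifold (𝓡 m) ∞ H]
  {E : Type*} [NormedAddCommGroup E] [NormedSpace ℝ E]

/-- The scalar products of a Riemannian metric, as forms on the model space `𝔼 m`. -/
def innerAt (g : Metric m H) : H → Form (𝔼 m) := g.inner

/-- Smoothness at `x₀` of a field of bilinear forms on the tangent spaces of `H`. -/
def IsSmoothFormAt (s : H → Form (𝔼 m)) (x₀ : H) : Prop :=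
  ContMDiffAt (𝓡 m) ((𝓡 m).prod 𝓘(ℝ, Form (𝔼 m))) ∞
    (fun x => Bundle.TotalSpace.mk' (Form (𝔼 m))
      (E := fun x : H => TangentSpace (𝓡 m) x →L[ℝ] TangentSpace (𝓡 m) x →L[ℝ] ℝ) x (s x)) x₀

theorem trivializationAt_form (s : H → Form (𝔼 m)) {x₀ x : H} (hx : x ∈ (chartAt (𝔼 m) x₀).source) :
    (trivializationAt (Form (𝔼 m))
      (fun x : H => TangentSpace (𝓡 m) x →L[ℝ] TangentSpace (𝓡 m) x →L[ℝ] ℝ) x₀ ⟨x, s x⟩).2 =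
      pullback s (extChartAt (𝓡 m) x₀).symm (extChartAt (𝓡 m) x₀ x) := by
  have hsymm := TangentBundle.symmL_trivializationAt (I := 𝓡 m) hx
  have hleft : (extChartAt (𝓡 m) x₀).symm (extChartAt (𝓡 m) x₀ x) = x :=
    (extChartAt (𝓡 m) x₀).left_inv (by rwa [extChartAt_source])
  rw [ModelWithCorners.range_eq_univ, mfderivWithin_univ] at hsymm
  ext v w
  rw [pullback_apply, paramDeriv, ← hsymm, hleft]
  simp [hom_trivializationAt_apply, ContinuousLinearMap.inCoordinates, hx,
    Bundle.Trivialization.linearMapAt_apply]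
  rfl

theorem isSmoothFormAt_iff (s : H → Form (𝔼 m)) (x₀ : H) :
    IsSmoothFormAt s x₀ ↔
      ContDiffAt ℝ ∞ (pullback s (extChartAt (𝓡 m) x₀).symm) (extChartAt (𝓡 m) x₀ x₀) := by
  have htriv : (fun x => (trivializationAt (Form (𝔼 m))
      (fun x : H => TangentSpace (𝓡 m) x →L[ℝ] TangentSpace (𝓡 m) x →L[ℝ] ℝ) x₀ ⟨x, s x⟩).2)
      =ᶠ[𝓝 x₀] pullback s (extChartAt (𝓡 m) x₀).symm ∘ extChartAt (𝓡 m) x₀ :=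
    Filter.mem_of_superset (chart_source_mem_nhds (𝔼 m) x₀) fun x hx => trivializationAt_form s hx
  have hsection : IsSmoothFormAt s x₀ ↔ _ := Bundle.contMDiffAt_section
    (E := fun x : H => TangentSpace (𝓡 m) x →L[ℝ] TangentSpace (𝓡 m) x →L[ℝ] ℝ) x₀
  rw [hsection, htriv.contMDiffAt_iff, ← contMDiffAt_iff_contDiffAt]
  refine ⟨fun h => ?_, fun h => h.comp x₀ contMDiffAt_extChartAt⟩
  refine (h.comp_of_eq (isParamAt_extChartAt_symm (mem_extChartAt_target x₀)).contMDiffAt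
    (extChartAt_to_inv x₀)).congr_of_eventuallyEq ?_
  filter_upwards [extChartAt_target_mem_nhds (I := 𝓡 m) x₀] with y hy
  simp only [Function.comp_apply, (extChartAt (𝓡 m) x₀).right_inv hy]

theorem IsParamAt.isSmoothFormAt [CompleteSpace E] {s : H → Form (𝔼 m)} {ψ : E → H} {y : E}
    (hψ : IsParamAt (m := m) ψ y) (hs : ContDiffAt ℝ ∞ (pullback s ψ) y) :
    IsSmoothFormAt s (ψ y) := by
  obtain ⟨θ, hθ, hθy, hsymm⟩ := hψ.exists_localInverse
  rw [isSmoothFormAt_iff]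
  exact (contDiffAt_pullForm (n := ∞) (m := ∞) (by simp) hθ
    (hθy.symm ▸ hs)).congr_of_eventuallyEq
      (pullback_eventuallyEq_pullForm s hsymm (hθy.symm ▸ hψ.contMDiffAt) hθ)

theorem contDiffAt_coordMetric (g : Metric m H) (x : H) :
    ContDiffAt ℝ ∞ (coordMetric g x) (extChartAt (𝓡 m) x x) :=
  (isSmoothFormAt_iff (innerAt g) x).1 (g.contMDiff x)

theorem contDiffAt_pullback (g : Metric m H) {ψ : E → H} {y : E}
    (hψ : ContMDiffAt 𝓘(ℝ, E) (𝓡 m) ∞ ψ y) : ContDiffAt ℝ ∞ (pullback (innerAt g) ψ) y :=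
  (contDiffAt_pullForm (n := ∞) (m := ∞) (by simp) (contDiffAt_extChartAt_comp hψ)
    (contDiffAt_coordMetric g (ψ y))).congr_of_eventuallyEq (pullback_eventuallyEq _ hψ)

theorem pullback_symm (g : Metric m H) (ψ : E → H) (y v w : E) :
    pullback (innerAt g) ψ y v w = pullback (innerAt g) ψ y w v :=
  g.symm _ _ _

theorem IsParamAt.pullback_pos (g : Metric m H) {ψ : E → H} {y : E} (hψ : IsParamAt (m := m) ψ y)
    {v : E} (hv : v ≠ 0) : 0 < pullback (innerAt g) ψ y v v :=
  g.pos _ _ fun h => hv (hψ.isInvertible.injective (h.trans (map_zero _).symm))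

theorem isInvertible_coordMetric (g : Metric m H) (x : H) :
    (coordMetric g x (extChartAt (𝓡 m) x x)).IsInvertible :=
  isInvertible_of_posDef fun _ hv =>
    (isParamAt_extChartAt_symm (mem_extChartAt_target x)).pullback_pos g hv

theorem IsParamAt.paramDeriv_christoffel_pullback (g : Metric m H) {ψ : E → H} {z : E} {x : H}
    (hψ : IsParamAt (m := m) ψ z) (hx : ψ z = x) (a b : E) :
    paramDeriv ψ z (christoffel (pullback (innerAt g) ψ) z a b) =
      fderiv ℝ (fderiv ℝ (extChartAt (𝓡 m) x ∘ ψ)) z a b +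
        christoffel (coordMetric g x) (extChartAt (𝓡 m) x x)
          (fderiv ℝ (extChartAt (𝓡 m) x ∘ ψ) z a) (fderiv ℝ (extChartAt (𝓡 m) x ∘ ψ) z b) := by
  subst hx
  have hφ := contDiffAt_extChartAt_comp hψ.contMDiffAt
  have hderiv := paramDeriv_eq_fderiv_extChartAt_comp rfl
    (hψ.contMDiffAt.mdifferentiableAt (by simp))
  have hmetric := pullback_eventuallyEq (innerAt g) hψ.contMDiffAt
  have hchr : christoffel (pullback (innerAt g) ψ) z a b = christoffel (pullForm
      (extChartAt (𝓡 m) (ψ z) ∘ ψ) (coordMetric g (ψ z))) z a b := by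
    rw [christoffel, hmetric.eq_of_nhds, hmetric.fderiv_eq]
    rfl
  rw [hchr, hderiv]
  exact fderiv_christoffel_pullForm (hφ.of_le ENat.LEInfty.out) (hderiv ▸ hψ.isInvertible)
    ((contDiffAt_coordMetric g (ψ z)).of_le ENat.LEInfty.out)
    (pullback_symm g _ _) (isInvertible_coordMetric g (ψ z)) a b

variable [FiniteDimensional ℝ E]

theorem IsParamAt.scal_eq_scalCoord_pullback (g : Metric m H) {ψ : E → H} {y : E}
    (hψ : IsParamAt (m := m) ψ y) : scal g (ψ y) = scalCoord (pullback (innerAt g) ψ) y := by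
  have hA : (fderiv ℝ (extChartAt (𝓡 m) (ψ y) ∘ ψ) y).IsInvertible := by
    rw [← paramDeriv_eq_fderiv_extChartAt_comp rfl (hψ.contMDiffAt.mdifferentiableAt (by simp))]
    exact hψ.isInvertible
  rw [scalCoord_congr (pullback_eventuallyEq _ hψ.contMDiffAt)]
  exact (scalCoord_pullForm ((contDiffAt_extChartAt_comp hψ.contMDiffAt).of_le ENat.LEInfty.out)
    hA ((contDiffAt_coordMetric g (ψ y)).of_le ENat.LEInfty.out)
    (Filter.Eventually.of_forall (pullback_symm g _)) (isInvertible_coordMetric g (ψ y))).symm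

end Metric

/-! ### Fermi charts -/

section FermiForm

variable {E : Type*} [NormedAddCommGroup E] [NormedSpace ℝ E]
  {F : Type*} [NormedAddCommGroup F] [NormedSpace ℝ F]

theorem eq_comp_snd_of_apply_dt {l : ℝ × E →L[ℝ] F} (hl : l (1, 0) = 0) :
    l = (l ∘L ContinuousLinearMap.inr ℝ ℝ E) ∘L ContinuousLinearMap.snd ℝ ℝ E := by
  refine ContinuousLinearMap.ext fun v => ?_
  have hv : v = v.1 • ((1 : ℝ), (0 : E)) + (0, v.2) := by ext <;> simp
  conv_lhs => rw [hv, map_add, map_smul, hl, smul_zero, zero_add]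
  rfl

theorem IsFermiForm.bilinearComp_prodMap {b : Form (ℝ × E)} (hb : IsFermiForm b) {A : F →L[ℝ] E}
    (hA : Function.Injective A) :
    IsFermiForm (b.bilinearComp ((ContinuousLinearMap.id ℝ ℝ).prodMap A)
      ((ContinuousLinearMap.id ℝ ℝ).prodMap A)) where
  symm v w := hb.symm _ _
  pos v hv := hb.pos _ fun h => hv <|
    Function.Injective.prodMap Function.injective_id hA (h.trans (Prod.ext rfl (map_zero A).symm))
  apply_dt v := by
    have h := hb.apply_dt (v.1, A v.2)
    rwa [← map_zero A] at h

theorem IsFermiForm.apply_inr {b : Form (ℝ × E)} (hb : IsFermiForm b) (u : E) :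
    b (0, u) = (b.bilinearComp (ContinuousLinearMap.inr ℝ ℝ E) (ContinuousLinearMap.inr ℝ ℝ E) u)
      ∘L ContinuousLinearMap.snd ℝ ℝ E :=
  eq_comp_snd_of_apply_dt (by rw [hb.symm, hb.apply_dt])

variable [FiniteDimensional ℝ E]

theorem IsFermiForm.metricTrace_eq {b : Form (ℝ × E)} (hb : IsFermiForm b) {β : Form (ℝ × E)}
    (hβ : ∀ v, β v (1, 0) = 0) (hβ' : β (1, 0) = 0) :
    metricTrace b (fun v w => β v w) = metricTrace
      (b.bilinearComp (ContinuousLinearMap.inr ℝ ℝ E) (ContinuousLinearMap.inr ℝ ℝ E))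
      (fun v w => β (0, v) (0, w)) := by
  set inr := ContinuousLinearMap.inr ℝ ℝ E with hinr
  set b₀ := b.bilinearComp inr inr with hb₀
  let β₀ : Form E := β.bilinearComp inr inr
  have hb₀_inv : b₀.IsInvertible :=
    isInvertible_of_posDef fun v hv => hb.pos (0, v) (by simpa using hv)
  have hraise : b.inverse ∘L β = (inr ∘L (b₀.inverse ∘L β₀)) ∘L ContinuousLinearMap.snd ℝ ℝ E := by
    refine ContinuousLinearMap.ext fun v => ?_
    have hβv : β v = b (0, b₀.inverse (β₀ v.2)) := by
      rw [hb.apply_inr, ← hinr, ← hb₀, hb₀_inv.self_apply_inverse, eq_comp_snd_of_apply_dt (hβ v)]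
      rw [congrArg (fun l => l v) (eq_comp_snd_of_apply_dt hβ')]
      rfl
    simp only [ContinuousLinearMap.comp_apply]
    rw [hβv, (isInvertible_of_posDef hb.pos).inverse_apply_self]
    rfl
  change _ = metricTrace b₀ (fun v w => β₀ v w)
  rw [metricTrace_eq_endTrace, metricTrace_eq_endTrace, hraise, endTrace_apply, endTrace_apply]
  exact (LinearMap.trace_comp_comm'
    ((inr ∘L (b₀.inverse ∘L β₀) : E →L[ℝ] ℝ × E) : E →ₗ[ℝ] ℝ × E) (LinearMap.snd ℝ ℝ E)).symm

theorem IsFermiForm.christoffel_fst {G : ℝ × E → Form (ℝ × E)} {z : ℝ × E}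
    (hF : ∀ᶠ z' in 𝓝 z, IsFermiForm (G z')) (hG : DifferentiableAt ℝ G z) (v w : E) :
    (christoffel G z (0, v) (0, w)).1 = -(1 / 2) * fderiv ℝ G z (1, 0) (0, v) (0, w) := by
  have hz := hF.self_of_nhds
  have hdt (u : ℝ × E) (w : E) : fderiv ℝ G z u (0, w) (1, 0) = 0 := by
    rw [fderiv_apply_symm hG (hF.mono fun _ h => h.symm), fderiv_apply_dt hF hG]
  rw [← hz.apply_dt, hz.symm, apply_christoffel (isInvertible_of_posDef hz.pos), hdt, hdt]
  ring

end FermiForm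

section FermiChart

variable {m n : ℕ} {H : Type*} [TopologicalSpace H] [ChartedSpace (𝔼 m) H]
  {W : Type*} [TopologicalSpace W] [ChartedSpace (𝔼 n) W]

/-- The differential of `Φ : ℝ × W → H`, as a map between the model spaces. -/
def dPhi (Φ : ℝ × W → H) (u : ℝ × W) : ℝ × 𝔼 n →L[ℝ] 𝔼 m :=
  mfderiv (𝓘(ℝ, ℝ).prod (𝓡 n)) (𝓡 m) Φ u

/-- The pull-back `Φ^* s` of a field of bilinear forms on `H`, as forms on the model space of
`ℝ × W`. -/
def fermiPullback (s : H → Form (𝔼 m)) (Φ : ℝ × W → H) (u : ℝ × W) : Form (ℝ × 𝔼 n) :=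
  (s (Φ u)).bilinearComp (dPhi Φ u) (dPhi Φ u)

/-- The parametrization of `H` given by `Φ` and the preferred chart of `W` at `p`. -/
def fermiChart (n : ℕ) [ChartedSpace (𝔼 n) W] (Φ : ℝ × W → H) (p : W) : ℝ × 𝔼 n → H :=
  Φ ∘ Prod.map id (extChartAt (𝓡 n) p).symm

/-- The part of the coordinate space on which `fermiChart` is a parametrization, for a Fermi
decomposition `Φ` of width `σ`. -/
def fermiDomain (n : ℕ) [ChartedSpace (𝔼 n) W] (σ : ℝ) (p : W) : Set (ℝ × 𝔼 n) :=
  Set.Ioo (-σ) σ ×ˢ (extChartAt (𝓡 n) p).target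

theorem fermiChart_self {X : Type*} (Φ : ℝ × W → X) (p : W) (t : ℝ) :
    fermiChart n Φ p (t, extChartAt (𝓡 n) p p) = Φ (t, p) :=
  congrArg (fun q => Φ (t, q)) (extChartAt_to_inv p)

theorem mem_fermiDomain_self {σ t : ℝ} (ht : t ∈ Set.Ioo (-σ) σ) (p : W) :
    (t, extChartAt (𝓡 n) p p) ∈ fermiDomain n σ p :=
  ⟨ht, mem_extChartAt_target p⟩

theorem isOpen_fermiDomain (σ : ℝ) (p : W) : IsOpen (fermiDomain n σ p) :=
  isOpen_Ioo.prod (isOpen_extChartAt_target p)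

variable {Φ : ℝ × W → H}

theorem dt_eq_dPhi {t : ℝ} {p : W}
    (hΦ : MDifferentiableAt (𝓘(ℝ, ℝ).prod (𝓡 n)) (𝓡 m) Φ (t, p)) :
    dt (m := m) Φ t p = dPhi (m := m) (n := n) Φ (t, p) (1, 0) := by
  have hcomp := mfderiv_comp (f := fun s : ℝ => (s, p)) t hΦ
    (mdifferentiableAt_id.prodMk mdifferentiableAt_const)
  rw [mfderiv_prod_left] at hcomp
  exact congrArg (fun L => L (1 : ℝ)) hcomp

theorem dslice_eq_dPhi {t : ℝ} {p : W}
    (hΦ : MDifferentiableAt (𝓘(ℝ, ℝ).prod (𝓡 n)) (𝓡 m) Φ (t, p)) (v : TangentSpace (𝓡 n) p) :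
    dslice (m := m) Φ t p v = dPhi (m := m) (n := n) Φ (t, p) (0, v) := by
  have hcomp := mfderiv_comp (f := fun q : W => (t, q)) p hΦ
    (mdifferentiableAt_const.prodMk mdifferentiableAt_id)
  rw [mfderiv_prod_right] at hcomp
  exact congrArg (fun L => L v) hcomp

section

variable [IsManifold (𝓡 n) ∞ W]

theorem contMDiffAt_prodMap_extChartAt_symm {p : W} {z : ℝ × 𝔼 n}
    (hz : z.2 ∈ (extChartAt (𝓡 n) p).target) :
    ContMDiffAt 𝓘(ℝ, ℝ × 𝔼 n) (𝓘(ℝ, ℝ).prod (𝓡 n)) ∞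
      (Prod.map id (extChartAt (𝓡 n) p).symm) z := by
  rw [modelWithCornersSelf_prod, ← chartedSpaceSelf_prod]
  exact contMDiffAt_id.prodMap' (isParamAt_extChartAt_symm hz).contMDiffAt

theorem mfderiv_prodMap_extChartAt_symm {p : W} {z : ℝ × 𝔼 n}
    (hz : z.2 ∈ (extChartAt (𝓡 n) p).target) :
    (mfderiv 𝓘(ℝ, ℝ × 𝔼 n) (𝓘(ℝ, ℝ).prod (𝓡 n)) (Prod.map id (extChartAt (𝓡 n) p).symm) z :
        ℝ × 𝔼 n →L[ℝ] ℝ × 𝔼 n) =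
      (ContinuousLinearMap.id ℝ ℝ).prodMap (paramDeriv (extChartAt (𝓡 n) p).symm z.2) := by
  rw [modelWithCornersSelf_prod, ← chartedSpaceSelf_prod, mfderiv_prodMap mdifferentiableAt_id
    ((isParamAt_extChartAt_symm hz).contMDiffAt.mdifferentiableAt (by simp)), mfderiv_id]
  rfl

theorem paramDeriv_fermiChart {p : W} {z : ℝ × 𝔼 n} (hz : z.2 ∈ (extChartAt (𝓡 n) p).target)
    (hΦ : MDifferentiableAt (𝓘(ℝ, ℝ).prod (𝓡 n)) (𝓡 m) Φ (z.1, (extChartAt (𝓡 n) p).symm z.2)) :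
    paramDeriv (m := m) (fermiChart n Φ p) z =
      (dPhi (n := n) Φ (z.1, (extChartAt (𝓡 n) p).symm z.2)).comp
      ((ContinuousLinearMap.id ℝ ℝ).prodMap (paramDeriv (extChartAt (𝓡 n) p).symm z.2)) := by
  rw [← mfderiv_prodMap_extChartAt_symm hz]
  exact mfderiv_comp z hΦ ((contMDiffAt_prodMap_extChartAt_symm hz).mdifferentiableAt (by simp))

theorem pullback_fermiChart (s : H → Form (𝔼 m)) {p : W} {z : ℝ × 𝔼 n}
    (hz : z.2 ∈ (extChartAt (𝓡 n) p).target)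
    (hΦ : MDifferentiableAt (𝓘(ℝ, ℝ).prod (𝓡 n)) (𝓡 m) Φ (z.1, (extChartAt (𝓡 n) p).symm z.2)) :
    pullback s (fermiChart n Φ p) z =
      (fermiPullback (n := n) s Φ (z.1, (extChartAt (𝓡 n) p).symm z.2)).bilinearComp
        ((ContinuousLinearMap.id ℝ ℝ).prodMap (paramDeriv (extChartAt (𝓡 n) p).symm z.2))
        ((ContinuousLinearMap.id ℝ ℝ).prodMap (paramDeriv (extChartAt (𝓡 n) p).symm z.2)) := by
  rw [pullback, paramDeriv_fermiChart hz hΦ]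
  rfl

theorem paramDeriv_fermiChart_self {t : ℝ} {p : W}
    (hΦ : MDifferentiableAt (𝓘(ℝ, ℝ).prod (𝓡 n)) (𝓡 m) Φ (t, p)) :
    paramDeriv (m := m) (fermiChart n Φ p) (t, extChartAt (𝓡 n) p p) = dPhi Φ (t, p) := by
  rw [paramDeriv_fermiChart (mem_extChartAt_target p) (by rwa [extChartAt_to_inv]),
    paramDeriv_extChartAt_symm_self, extChartAt_to_inv]
  rfl

theorem pullback_fermiChart_self (s : H → Form (𝔼 m)) {t : ℝ} {p : W}
    (hΦ : MDifferentiableAt (𝓘(ℝ, ℝ).prod (𝓡 n)) (𝓡 m) Φ (t, p)) :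
    pullback s (fermiChart n Φ p) (t, extChartAt (𝓡 n) p p) = fermiPullback s Φ (t, p) := by
  rw [pullback, fermiPullback, paramDeriv_fermiChart_self hΦ, fermiChart_self]

end

variable [IsManifold (𝓡 m) ∞ H] {g : Metric m H} {ι : W → H}
  {ν : ∀ p : W, TangentSpace (𝓡 m) (ι p)} {σ : ℝ}

theorem IsFermi.contMDiffAt (hΦ : IsFermi (n := n) g ι ν σ Φ) {t : ℝ} (ht : t ∈ Set.Ioo (-σ) σ)
    (p : W) : ContMDiffAt (𝓘(ℝ, ℝ).prod (𝓡 n)) (𝓡 m) ∞ Φ (t, p) :=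
  (hΦ.isLocalDiffeomorphOn ⟨(t, p), ht, trivial⟩).contMDiffAt

theorem IsFermi.mdifferentiableAt (hΦ : IsFermi (n := n) g ι ν σ Φ) {t : ℝ}
    (ht : t ∈ Set.Ioo (-σ) σ) (p : W) :
    MDifferentiableAt (𝓘(ℝ, ℝ).prod (𝓡 n)) (𝓡 m) Φ (t, p) :=
  (hΦ.contMDiffAt ht p).mdifferentiableAt (by simp)

theorem IsFermi.isInvertible_dPhi (hΦ : IsFermi (n := n) g ι ν σ Φ) {t : ℝ}
    (ht : t ∈ Set.Ioo (-σ) σ) (p : W) : (dPhi (m := m) (n := n) Φ (t, p)).IsInvertible :=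
  ⟨(hΦ.isLocalDiffeomorphOn ⟨(t, p), ht, trivial⟩).mfderivToContinuousLinearEquiv (by simp), rfl⟩

theorem IsFermi.isFermiForm_fermiPullback (hΦ : IsFermi (n := n) g ι ν σ Φ) {t : ℝ}
    (ht : t ∈ Set.Ioo (-σ) σ) (p : W) :
    IsFermiForm (fermiPullback (n := n) (innerAt g) Φ (t, p)) where
  symm v w := g.symm _ _ _
  pos v hv := g.pos _ _ fun h => hv ((hΦ.isInvertible_dPhi ht p).injective
    (h.trans (map_zero _).symm))
  apply_dt v := by
    obtain ⟨hunit, horth, -⟩ := hΦ.hasForm t ht p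
    have hv : v = v.1 • ((1 : ℝ), (0 : 𝔼 n)) + (0, v.2) := by ext <;> simp
    have hdt := dt_eq_dPhi (hΦ.mdifferentiableAt ht p)
    have hslice := dslice_eq_dPhi (hΦ.mdifferentiableAt ht p) v.2
    have hunit' : fermiPullback (n := n) (innerAt g) Φ (t, p) (1, 0) (1, 0) = 1 :=
      (congrArg₂ (fun a b => innerAt g (Φ (t, p)) a b) hdt hdt).symm.trans hunit
    have horth' : fermiPullback (n := n) (innerAt g) Φ (t, p) (1, 0) (0, v.2) = 0 :=
      (congrArg₂ (fun a b => innerAt g (Φ (t, p)) a b) hdt hslice).symm.trans (horth v.2)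
    conv_lhs => rw [hv]
    rw [map_add, map_smul, hunit', horth', smul_eq_mul, mul_one, add_zero]

variable [IsManifold (𝓡 n) ∞ W]

theorem IsFermi.isParamAt_fermiChart (hΦ : IsFermi (n := n) g ι ν σ Φ) {p : W} {z : ℝ × 𝔼 n}
    (hz : z ∈ fermiDomain n σ p) : IsParamAt (m := m) (fermiChart n Φ p) z where
  contMDiffAt := (hΦ.contMDiffAt hz.1 _).comp z (contMDiffAt_prodMap_extChartAt_symm hz.2)
  isInvertible := by
    obtain ⟨A, hA⟩ := (isParamAt_extChartAt_symm hz.2).isInvertible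
    rw [paramDeriv_fermiChart hz.2 (hΦ.mdifferentiableAt hz.1 _), ← hA]
    exact (hΦ.isInvertible_dPhi hz.1 _).comp
      ⟨(ContinuousLinearEquiv.refl ℝ ℝ).prodCongr A, rfl⟩

theorem IsFermi.isFermiForm (hΦ : IsFermi (n := n) g ι ν σ Φ) {p : W} {z : ℝ × 𝔼 n}
    (hz : z ∈ fermiDomain n σ p) : IsFermiForm (pullback (innerAt g) (fermiChart n Φ p) z) := by
  rw [pullback_fermiChart _ hz.2 (hΦ.mdifferentiableAt hz.1 _)]
  exact (hΦ.isFermiForm_fermiPullback hz.1 _).bilinearComp_prodMap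
    (isParamAt_extChartAt_symm hz.2).isInvertible.injective

theorem IsFermi.eventually_isFermiForm (hΦ : IsFermi (n := n) g ι ν σ Φ) {p : W} {z : ℝ × 𝔼 n}
    (hz : z ∈ fermiDomain n σ p) :
    ∀ᶠ z' in 𝓝 z, IsFermiForm (pullback (innerAt g) (fermiChart n Φ p) z') :=
  ((isOpen_fermiDomain σ p).eventually_mem hz).mono fun _ h => hΦ.isFermiForm h

end FermiChart

/-! ### The second fundamental form of a Fermi slice -/

section Slice

variable {E : Type*} [NormedAddCommGroup E] [NormedSpace ℝ E]
  {F : Type*} [NormedAddCommGroup F] [NormedSpace ℝ F]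

theorem fderiv_slice {φ : ℝ × E → F} {t : ℝ} {y : E} (hφ : DifferentiableAt ℝ φ (t, y)) (w : E) :
    fderiv ℝ (fun y => φ (t, y)) y w = fderiv ℝ φ (t, y) (0, w) :=
  congrArg (fun L => L w) (hφ.hasFDerivAt.comp y (hasFDerivAt_prodMk_right t y)).fderiv

theorem fderiv_fderiv_slice {φ : ℝ × E → F} {t : ℝ} {y : E} (hφ : ContDiffAt ℝ ∞ φ (t, y))
    (v w : E) : fderiv ℝ (fun y => fderiv ℝ (fun y => φ (t, y)) y w) y v =
      fderiv ℝ (fderiv ℝ φ) (t, y) (0, v) (0, w) := by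
  have hinner : (fun y => fderiv ℝ (fun y => φ (t, y)) y w) =ᶠ[𝓝 y]
      fun y => fderiv ℝ φ (t, y) (0, w) :=
    ((hasFDerivAt_prodMk_right (𝕜 := ℝ) t y).continuousAt.eventually
      (eventually_differentiableAt hφ)).mono
      fun y hy => fderiv_slice hy w
  have hφ' : DifferentiableAt ℝ (fderiv ℝ φ) (t, y) :=
    (hφ.fderiv_right (m := ∞) (by simp)).differentiableAt (by simp)
  rw [hinner.fderiv_eq, fderiv_slice (φ := fun z : ℝ × E => fderiv ℝ φ z (0, w))
    (hφ'.clm_apply (differentiableAt_const _)), fderiv_clm_apply hφ' (differentiableAt_const _)]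
  simp

end Slice

section SecondFundamentalForm

variable {m n : ℕ} {H : Type*} [TopologicalSpace H] [ChartedSpace (𝔼 m) H]
  [IsManifold (𝓡 m) ∞ H] {W : Type*} [TopologicalSpace W] [ChartedSpace (𝔼 n) W]
  {Φ : ℝ × W → H} {g : Metric m H} {ι : W → H} {ν : ∀ p : W, TangentSpace (𝓡 m) (ι p)} {σ : ℝ}

theorem secondDeriv_slice (g : Metric m H) {p : W} {t : ℝ}
    (hψ : IsParamAt (m := m) (fermiChart n Φ p) (t, extChartAt (𝓡 n) p p)) (v w : 𝔼 n) :
    (secondDeriv g (fun q => Φ (t, q)) p v w : 𝔼 m) =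
      paramDeriv (fermiChart n Φ p) (t, extChartAt (𝓡 n) p p)
        (christoffel (pullback (innerAt g) (fermiChart n Φ p)) (t, extChartAt (𝓡 n) p p)
          (0, v) (0, w)) := by
  have hφ := contDiffAt_extChartAt_comp hψ.contMDiffAt
  rw [fermiChart_self] at hφ
  have hφ' := hφ.differentiableAt (by simp)
  rw [hψ.paramDeriv_christoffel_pullback g (fermiChart_self Φ p t), ← fderiv_fderiv_slice hφ,
    ← fderiv_slice hφ', ← fderiv_slice hφ']
  have hpoint : extChartAt (𝓡 m) (Φ (t, p)) (Φ (t, p)) =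
      writtenInExtChartAt (𝓡 n) (𝓡 m) p (fun q => Φ (t, q)) (extChartAt (𝓡 n) p p) := by
    simp only [writtenInExtChartAt, Function.comp_apply, extChartAt_to_inv]
  rw [hpoint]
  rfl

theorem IsFermi.apply_zero (hΦ : IsFermi (n := n) g ι ν σ Φ) : ι = fun p => Φ (0, p) :=
  funext fun p => (congrArg Bundle.TotalSpace.proj (hΦ.initial p)).symm

theorem IsFermi.zero_mem (hΦ : IsFermi (n := n) g ι ν σ Φ) : (0 : ℝ) ∈ Set.Ioo (-σ) σ :=
  ⟨by linarith [hΦ.pos], hΦ.pos⟩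

theorem IsFermi.mfderiv_eq_dPhi (hΦ : IsFermi (n := n) g ι ν σ Φ) (p : W) (v : 𝔼 n) :
    (mfderiv (𝓡 n) (𝓡 m) ι p v : 𝔼 m) = dPhi (m := m) Φ (0, p) (0, v) := by
  obtain rfl := hΦ.apply_zero
  exact dslice_eq_dPhi (hΦ.mdifferentiableAt hΦ.zero_mem p) v

theorem IsFermi.normal_eq_dPhi (hΦ : IsFermi (n := n) g ι ν σ Φ) (p : W) :
    (ν p : 𝔼 m) = dPhi (m := m) (n := n) Φ (0, p) (1, 0) := by
  obtain rfl := hΦ.apply_zero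
  rw [← dt_eq_dPhi (hΦ.mdifferentiableAt hΦ.zero_mem p)]
  exact (eq_of_heq (Bundle.TotalSpace.mk.inj (hΦ.initial p)).2).symm

theorem IsFermi.inducedMetric_eq (hΦ : IsFermi (n := n) g ι ν σ Φ) (p : W) :
    inducedMetric (n := n) g ι p =
      (fermiPullback (innerAt g) Φ (0, p)).bilinearComp
        (ContinuousLinearMap.inr ℝ ℝ (𝔼 n)) (ContinuousLinearMap.inr ℝ ℝ (𝔼 n)) := by
  refine ContinuousLinearMap.ext fun v => ContinuousLinearMap.ext fun w => ?_
  refine (congrArg₂ (fun a b => innerAt g (ι p) a b) (hΦ.mfderiv_eq_dPhi p v)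
    (hΦ.mfderiv_eq_dPhi p w)).trans ?_
  rw [congrFun hΦ.apply_zero p]
  rfl

variable [IsManifold (𝓡 n) ∞ W]

theorem IsFermi.exists_secondDeriv_eq (hΦ : IsFermi (n := n) g ι ν σ Φ) (g' : Metric m H) {p : W}
    (hF : ∀ᶠ z in 𝓝 ((0 : ℝ), extChartAt (𝓡 n) p p),
      IsFermiForm (pullback (innerAt g') (fermiChart n Φ p) z)) (v w : 𝔼 n) :
    ∃ x : 𝔼 n, (secondDeriv g' ι p v w : 𝔼 m) = dPhi Φ (0, p)
      (-(1 / 2) * fderiv ℝ (pullback (innerAt g') (fermiChart n Φ p))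
        (0, extChartAt (𝓡 n) p p) (1, 0) (0, v) (0, w), x) := by
  obtain rfl := hΦ.apply_zero
  have hψ := hΦ.isParamAt_fermiChart (mem_fermiDomain_self hΦ.zero_mem p)
  refine ⟨(christoffel (pullback (innerAt g') (fermiChart n Φ p)) (0, extChartAt (𝓡 n) p p)
    (0, v) (0, w)).2, ?_⟩
  rw [secondDeriv_slice g' hψ, paramDeriv_fermiChart_self (hΦ.mdifferentiableAt hΦ.zero_mem p),
    ← IsFermiForm.christoffel_fst hF
      ((contDiffAt_pullback g' hψ.contMDiffAt).differentiableAt (by simp))]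

theorem IsFermi.meanCurvature_eq (hΦ : IsFermi (n := n) g ι ν σ Φ) (p : W) :
    meanCurvature (n := n) g ι ν p = -(1 / 2) *
      normalTrace (pullback (innerAt g) (fermiChart n Φ p)) (0, extChartAt (𝓡 n) p p) := by
  set G := pullback (innerAt g) (fermiChart n Φ p)
  have hz := mem_fermiDomain_self (n := n) hΦ.zero_mem p
  have hF := hΦ.eventually_isFermiForm hz
  have hGdiff : DifferentiableAt ℝ G (0, extChartAt (𝓡 n) p p) :=
    (contDiffAt_pullback g (hΦ.isParamAt_fermiChart hz).contMDiffAt).differentiableAt (by simp)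
  have hβ := IsFermiForm.fderiv_apply_dt hF hGdiff (1, 0)
  have hself := pullback_fermiChart_self (innerAt g) (hΦ.mdifferentiableAt hΦ.zero_mem p)
  have hsecond (v w : 𝔼 n) : g.inner (ι p) (secondDeriv (n := n) g ι p v w) (ν p) =
      -(1 / 2) * fderiv ℝ G (0, extChartAt (𝓡 n) p p) (1, 0) (0, v) (0, w) := by
    obtain ⟨x, hx⟩ := hΦ.exists_secondDeriv_eq g hF v w
    refine (congrArg₂ (fun a b => innerAt g (ι p) a b) hx (hΦ.normal_eq_dPhi p)).trans ?_
    have hform := hΦ.isFermiForm_fermiPullback hΦ.zero_mem p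
    rw [congrFun hΦ.apply_zero p]
    exact (hform.symm _ _).trans (hform.apply_dt _)
  have hβ' (v : ℝ × 𝔼 n) : fderiv ℝ G (0, extChartAt (𝓡 n) p p) (1, 0) v (1, 0) = 0 := by
    rw [fderiv_apply_symm hGdiff (hF.mono fun _ h => h.symm), hβ]
  rw [normalTrace, hF.self_of_nhds.metricTrace_eq hβ' (ContinuousLinearMap.ext hβ), hself,
    ← hΦ.inducedMetric_eq, meanCurvature]
  refine (congrArg (metricTrace (inducedMetric (n := n) g ι p))
    (funext fun v => funext fun w => hsecond v w)).trans ?_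
  simp only [metricTrace, Finset.mul_sum]
  exact Finset.sum_congr rfl fun i _ => Finset.sum_congr rfl fun j _ => by ring

theorem IsFermi.isTotallyGeodesic (hΦ : IsFermi (n := n) g ι ν σ Φ) (g' : Metric m H)
    (hF : ∀ p, ∀ᶠ z in 𝓝 ((0 : ℝ), extChartAt (𝓡 n) p p),
      IsFermiForm (pullback (innerAt g') (fermiChart n Φ p) z))
    (hd : ∀ p, fderiv ℝ (pullback (innerAt g') (fermiChart n Φ p)) (0, extChartAt (𝓡 n) p p)
      (1, 0) = 0) : IsTotallyGeodesic (n := n) g' ι := by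
  intro p v w
  obtain ⟨x, hx⟩ := hΦ.exists_secondDeriv_eq g' (hF p) v w
  refine ⟨x, (hΦ.mfderiv_eq_dPhi p x).trans ?_⟩
  rw [hx, hd p]
  simp
  rfl

end SecondFundamentalForm

/-! ### Bending a metric along a Fermi decomposition -/

section PositiveForm

variable {E : Type*} [NormedAddCommGroup E] [NormedSpace ℝ E] [FiniteDimensional ℝ E]

theorem exists_pos_mul_norm_sq_le {b : Form E} (hb : ∀ v, v ≠ 0 → 0 < b v v) :
    ∃ c, 0 < c ∧ ∀ v, c * ‖v‖ ^ 2 ≤ b v v := by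
  obtain ⟨c, hc, hcb⟩ := (isCompact_sphere (0 : E) 1).exists_forall_le' (f := fun v => b v v)
    (by fun_prop) (a := 0) fun v hv => hb v (ne_zero_of_mem_unit_sphere ⟨v, hv⟩)
  refine ⟨c, hc, fun v => ?_⟩
  rcases eq_or_ne v 0 with rfl | hv
  · simp
  · have hunit := hcb (‖v‖⁻¹ • v) (by simp [norm_smul, hv])
    simp only [map_smul, smul_apply, smul_eq_mul] at hunit
    calc c * ‖v‖ ^ 2 ≤ ‖v‖⁻¹ * (‖v‖⁻¹ * b v v) * ‖v‖ ^ 2 := by gcongr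
      _ = b v v := by field_simp [norm_ne_zero_iff.2 hv]

theorem isVonNBounded_setOf_apply_lt_one {b : Form E} (hb : ∀ v, v ≠ 0 → 0 < b v v) :
    Bornology.IsVonNBounded ℝ {v | b v v < 1} := by
  obtain ⟨c, hc, hcb⟩ := exists_pos_mul_norm_sq_le hb
  refine (NormedSpace.isVonNBounded_iff ℝ).2 (isBounded_iff_forall_norm_le.2 ⟨√(1 / c), ?_⟩)
  intro v hv
  exact Real.le_sqrt_of_sq_le ((le_div_iff₀' hc).2 ((hcb v).trans hv.le))

end PositiveForm

section Metric

variable {m : ℕ} {H : Type*} [TopologicalSpace H] [ChartedSpace (𝔼 m) H] [IsManifold (𝓡 m) ∞ H]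

theorem exists_innerAt_eq {s : H → Form (𝔼 m)} (hsymm : ∀ x v w, s x v w = s x w v)
    (hpos : ∀ x v, v ≠ 0 → 0 < s x v v) (hs : ∀ x, IsSmoothFormAt s x) :
    ∃ g : Metric m H, innerAt g = s :=
  ⟨{ inner := s
     symm := hsymm
     pos := hpos
     isVonNBounded := fun x => isVonNBounded_setOf_apply_lt_one (E := 𝔼 m) (b := s x) (hpos x)
     contMDiff := hs }, rfl⟩

theorem scal_congr {g g' : Metric m H} {x : H} (h : innerAt g' =ᶠ[𝓝 x] innerAt g) :
    scal g' x = scal g x := by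
  refine scalCoord_congr ?_
  have hlim : Filter.Tendsto (extChartAt (𝓡 m) x).symm (𝓝 (extChartAt (𝓡 m) x x)) (𝓝 x) := by
    simpa only [extChartAt_to_inv] using (continuousAt_extChartAt_symm (I := 𝓡 m) x).tendsto
  filter_upwards [hlim.eventually h] with y hy
  exact congrArg (fun b : Form (𝔼 m) => b.bilinearComp (paramDeriv (extChartAt (𝓡 m) x).symm y)
    (paramDeriv (extChartAt (𝓡 m) x).symm y)) hy

end Metric

section Bending

variable {m n : ℕ} {H : Type*} [TopologicalSpace H] [ChartedSpace (𝔼 m) H]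
  {W : Type*} [TopologicalSpace W] [ChartedSpace (𝔼 n) W] {Φ : ℝ × W → H} {η : ℝ → ℝ}

/-- In the decomposition `Φ`, the field of forms `s'` at time `t` is the field `s` at time `η t`:
if `s` is `dt² + g_t`, then `s'` is `dt² + g_{η t}`. -/
def IsBentAt (n : ℕ) [ChartedSpace (𝔼 n) W] (s s' : H → Form (𝔼 m)) (Φ : ℝ × W → H) (η : ℝ → ℝ)
    (t : ℝ) : Prop :=
  ∀ p, fermiPullback (n := n) s' Φ (t, p) = fermiPullback s Φ (η t, p)

open Classical in
/-- The field of forms obtained from `s` by replacing `dt² + g_t` by `dt² + g_{η t}` on the image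
of `(-σ, σ) × W` under `Φ`, which is assumed to be injective there. -/
def bentForm (n : ℕ) [ChartedSpace (𝔼 n) W] (s : H → Form (𝔼 m)) (Φ : ℝ × W → H) (σ : ℝ)
    (η : ℝ → ℝ) (x : H) : Form (𝔼 m) :=
  if hx : ∃ u ∈ Set.Ioo (-σ) σ ×ˢ (Set.univ : Set W), Φ u = x then
    (fermiPullback (n := n) s Φ (η hx.choose.1, hx.choose.2)).bilinearComp
      (dPhi Φ hx.choose).inverse (dPhi Φ hx.choose).inverse
  else s x

variable [IsManifold (𝓡 m) ∞ H] {g : Metric m H} {ι : W → H}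
  {ν : ∀ p : W, TangentSpace (𝓡 m) (ι p)} {σ : ℝ}

theorem bentForm_symm (g : Metric m H) (Φ : ℝ × W → H) (σ : ℝ) (η : ℝ → ℝ) (x : H) (v w : 𝔼 m) :
    bentForm n (innerAt g) Φ σ η x v w = bentForm n (innerAt g) Φ σ η x w v := by
  unfold bentForm
  split_ifs <;> exact g.symm _ _ _

theorem IsFermi.bentForm_apply (hΦ : IsFermi (n := n) g ι ν σ Φ) (s : H → Form (𝔼 m)) {t : ℝ}
    (ht : t ∈ Set.Ioo (-σ) σ) (p : W) :
    bentForm n s Φ σ η (Φ (t, p)) = (fermiPullback (n := n) s Φ (η t, p)).bilinearComp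
      (dPhi Φ (t, p)).inverse (dPhi Φ (t, p)).inverse := by
  have hx : ∃ u ∈ Set.Ioo (-σ) σ ×ˢ (Set.univ : Set W), Φ u = Φ (t, p) :=
    ⟨(t, p), ⟨ht, trivial⟩, rfl⟩
  have hu : hx.choose = (t, p) := hΦ.injOn hx.choose_spec.1 ⟨ht, trivial⟩ hx.choose_spec.2
  rw [bentForm, dif_pos hx, hu]

theorem IsFermi.isBentAt_bentForm (hΦ : IsFermi (n := n) g ι ν σ Φ) (s : H → Form (𝔼 m)) {t : ℝ}
    (ht : t ∈ Set.Ioo (-σ) σ) : IsBentAt n s (bentForm n s Φ σ η) Φ η t := by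
  intro p
  have hinv := hΦ.isInvertible_dPhi ht p
  refine ContinuousLinearMap.ext fun v => ContinuousLinearMap.ext fun w => ?_
  simp only [fermiPullback, hΦ.bentForm_apply s ht p, ContinuousLinearMap.bilinearComp_apply,
    hinv.inverse_apply_self]

theorem IsFermi.bentForm_eq_self (hΦ : IsFermi (n := n) g ι ν σ Φ) (s : H → Form (𝔼 m)) {x : H}
    (hx : ∀ t ∈ Set.Ioo (-σ) σ, ∀ p : W, Φ (t, p) = x → η t = t) :
    bentForm n s Φ σ η x = s x := by
  by_cases himage : ∃ u ∈ Set.Ioo (-σ) σ ×ˢ (Set.univ : Set W), Φ u = x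
  · obtain ⟨⟨t, p⟩, ⟨ht, -⟩, rfl⟩ := himage
    have hinv := hΦ.isInvertible_dPhi ht p
    refine ContinuousLinearMap.ext fun v => ContinuousLinearMap.ext fun w => ?_
    simp only [hΦ.bentForm_apply s ht p, hx t ht p rfl, fermiPullback,
      ContinuousLinearMap.bilinearComp_apply, hinv.self_apply_inverse]
  · rw [bentForm, dif_neg himage]

theorem IsFermi.bentForm_pos (hΦ : IsFermi (n := n) g ι ν σ Φ)
    (hη : Set.MapsTo η (Set.Ioo (-σ) σ) (Set.Ioo (-σ) σ)) (x : H) {v : 𝔼 m} (hv : v ≠ 0) :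
    0 < bentForm n (innerAt g) Φ σ η x v v := by
  by_cases himage : ∃ u ∈ Set.Ioo (-σ) σ ×ˢ (Set.univ : Set W), Φ u = x
  · obtain ⟨⟨t, p⟩, ⟨ht, -⟩, rfl⟩ := himage
    rw [hΦ.bentForm_apply _ ht p]
    refine (hΦ.isFermiForm_fermiPullback (hη ht) p).pos _ fun h => hv ?_
    have hinv := hΦ.isInvertible_dPhi ht p
    exact (hinv.self_apply_inverse v).symm.trans ((congrArg _ h).trans (map_zero _))
  · rw [bentForm, dif_neg himage]
    exact g.pos x v hv

theorem IsFermi.isClosed_image [T2Space H] [CompactSpace W] (hΦ : IsFermi (n := n) g ι ν σ Φ)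
    {a b : ℝ} (ha : -σ < a) (hb : b < σ) :
    IsClosed (Φ '' (Set.Icc a b ×ˢ (Set.univ : Set W))) :=
  ((isCompact_Icc.prod isCompact_univ).image_of_continuousOn fun u hu =>
    (hΦ.contMDiffAt ⟨ha.trans_le hu.1.1, hu.1.2.trans_lt hb⟩
      u.2).continuousAt.continuousWithinAt).isClosed

variable [IsManifold (𝓡 n) ∞ W]

theorem IsFermi.pullback_fermiChart_of_isBentAt (hΦ : IsFermi (n := n) g ι ν σ Φ) {p : W}
    {z : ℝ × 𝔼 n} (hz : z ∈ fermiDomain n σ p) (hη : η z.1 ∈ Set.Ioo (-σ) σ)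
    {s s' : H → Form (𝔼 m)} (hs : IsBentAt n s s' Φ η z.1) :
    pullback s' (fermiChart n Φ p) z = pullback s (fermiChart n Φ p) (η z.1, z.2) := by
  rw [pullback_fermiChart s' hz.2 (hΦ.mdifferentiableAt hz.1 _), hs,
    pullback_fermiChart s (z := (η z.1, z.2)) hz.2 (hΦ.mdifferentiableAt hη _)]

theorem IsFermi.isSmoothFormAt_bentForm (hΦ : IsFermi (n := n) g ι ν σ Φ) (hη : ContDiff ℝ ∞ η)
    (hmaps : Set.MapsTo η (Set.Ioo (-σ) σ) (Set.Ioo (-σ) σ)) {t : ℝ} (ht : t ∈ Set.Ioo (-σ) σ)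
    (p : W) : IsSmoothFormAt (bentForm n (innerAt g) Φ σ η) (Φ (t, p)) := by
  have hz := mem_fermiDomain_self (n := n) ht p
  rw [← fermiChart_self (n := n) Φ p t]
  refine (hΦ.isParamAt_fermiChart hz).isSmoothFormAt ?_
  have hbend : ContDiffAt ℝ ∞ (fun z : ℝ × 𝔼 n => (η z.1, z.2)) (t, extChartAt (𝓡 n) p p) :=
    ((hη.comp contDiff_fst).prodMk contDiff_snd).contDiffAt
  have hG := contDiffAt_pullback g
    (hΦ.isParamAt_fermiChart (z := (η t, extChartAt (𝓡 n) p p)) ⟨hmaps hz.1, hz.2⟩).contMDiffAt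
  refine (ContDiffAt.comp (t, extChartAt (𝓡 n) p p) hG hbend).congr_of_eventuallyEq ?_
  filter_upwards [(isOpen_fermiDomain σ p).mem_nhds hz] with z hz'
  exact hΦ.pullback_fermiChart_of_isBentAt hz' (hmaps hz'.1) (hΦ.isBentAt_bentForm _ hz'.1)

theorem IsFermi.exists_bentMetric [T2Space H] [CompactSpace W]
    (hΦ : IsFermi (n := n) g ι ν σ Φ) (hη : ContDiff ℝ ∞ η)
    (hmaps : Set.MapsTo η (Set.Ioo (-σ) σ) (Set.Ioo (-σ) σ)) {a b : ℝ} (ha : -σ < a) (hb : b < σ)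
    (hab : ∀ t, t ∉ Set.Icc a b → η t = t) :
    ∃ g' : Metric m H, (∀ t ∈ Set.Ioo (-σ) σ, IsBentAt n (innerAt g) (innerAt g') Φ η t) ∧
      ∀ x, (∀ t ∈ Set.Ioo (-σ) σ, ∀ p : W, Φ (t, p) = x → η t = t) →
        innerAt g' x = innerAt g x := by
  have hsmooth (x : H) : IsSmoothFormAt (bentForm n (innerAt g) Φ σ η) x := by
    by_cases himage : x ∈ Φ '' (Set.Icc a b ×ˢ (Set.univ : Set W))
    · obtain ⟨⟨t, p⟩, ⟨ht, -⟩, rfl⟩ := himage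
      exact hΦ.isSmoothFormAt_bentForm hη hmaps ⟨ha.trans_le ht.1, ht.2.trans_lt hb⟩ p
    · refine (g.contMDiff x).congr_of_eventuallyEq ?_
      filter_upwards [(hΦ.isClosed_image ha hb).isOpen_compl.mem_nhds himage] with y hy
      rw [hΦ.bentForm_eq_self _ fun t _ p hp => hab t fun ht => hy ⟨(t, p), ⟨ht, trivial⟩, hp⟩]
      rfl
  obtain ⟨g', hg'⟩ := exists_innerAt_eq (bentForm_symm (n := n) g Φ σ η)
    (fun x _ hv => hΦ.bentForm_pos hmaps x hv) hsmooth
  exact ⟨g', fun t ht => hg' ▸ hΦ.isBentAt_bentForm _ ht,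
    fun x hx => hg' ▸ hΦ.bentForm_eq_self _ hx⟩

end Bending

/-! ### Existence of compressions -/

section Primitive

open MeasureTheory intervalIntegral

/-- The primitive of `f` that vanishes at `0`. -/
def primitive (f : ℝ → ℝ) (t : ℝ) : ℝ :=
  ∫ s in (0 : ℝ)..t, f s

variable {f : ℝ → ℝ} {δ t : ℝ}

theorem primitive_zero : primitive f 0 = 0 :=
  integral_same

theorem deriv_primitive (hf : Continuous f) : deriv (primitive f) = f :=
  funext fun t => hf.deriv_integral f 0 t

theorem contDiff_primitive (hf : ContDiff ℝ ∞ f) : ContDiff ℝ ∞ (primitive f) := by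
  refine contDiff_infty_iff_deriv.2 ⟨?_, by rwa [deriv_primitive hf.continuous]⟩
  exact fun t => (hf.continuous.integral_hasStrictDerivAt 0 t).hasDerivAt.differentiableAt

theorem odd_primitive (hf : f.Even) : (primitive f).Odd := by
  intro t
  have hreflect := integral_comp_neg (a := 0) (b := t) f
  simp only [hf _, neg_zero] at hreflect
  rw [primitive, primitive, hreflect, integral_symm]

theorem even_primitive (hf : f.Odd) : (primitive f).Even := by
  intro t
  have hreflect := integral_comp_neg (a := 0) (b := t) f
  simp only [hf _, neg_zero, intervalIntegral.integral_neg] at hreflect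
  rw [primitive, primitive, integral_symm, ← hreflect, neg_neg]

theorem primitive_sub_primitive (hf : Continuous f) (a b : ℝ) :
    primitive f b - primitive f a = ∫ s in a..b, f s :=
  integral_interval_sub_left (hf.intervalIntegrable _ _) (hf.intervalIntegrable _ _)

theorem primitive_eq_add_of_eq_const (hf : Continuous f) {c : ℝ} (hc : ∀ s, δ ≤ s → f s = c)
    (ht : δ ≤ t) : primitive f t = primitive f δ + (t - δ) * c := by
  have hconst : ∫ s in δ..t, f s = ∫ _ in δ..t, c :=
    integral_congr fun s hs => hc s (Set.uIcc_of_le ht ▸ hs).1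
  rw [intervalIntegral.integral_const, smul_eq_mul, ← primitive_sub_primitive hf] at hconst
  linarith

/-- A smooth even bump function supported in `[-δ, δ]`, decreasing in `|t|` and of total mass `2`,
so that its primitive interpolates between `-1` and `1`. -/
structure IsEvenBump (δ : ℝ) (φ : ℝ → ℝ) : Prop where
  smooth : ContDiff ℝ ∞ φ
  even : φ.Even
  nonneg : ∀ t, 0 ≤ φ t
  eq_zero : ∀ t, δ ≤ t → φ t = 0
  antitoneOn : AntitoneOn φ (Set.Ici 0)
  primitive_eq_one : primitive φ δ = 1

theorem exists_isEvenBump (hδ : 0 < δ) : ∃ φ, IsEvenBump δ φ := by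
  set ψ : ℝ → ℝ := fun t => expNegInvGlue (δ ^ 2 - t ^ 2)
  have hsmooth : ContDiff ℝ ∞ ψ := expNegInvGlue.contDiff.comp (by fun_prop)
  have hmass : 0 < primitive ψ δ :=
    intervalIntegral_pos_of_pos_on (hsmooth.continuous.intervalIntegrable _ _)
      (fun t ht => expNegInvGlue.pos_of_pos (by nlinarith [ht.1, ht.2])) hδ
  exact ⟨fun t => ψ t / primitive ψ δ,
    { smooth := hsmooth.div_const _
      even := fun t => by simp only [ψ, neg_sq]
      nonneg := fun t => div_nonneg (expNegInvGlue.nonneg _) hmass.le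
      eq_zero := fun t ht => by
        rw [show ψ t = 0 from expNegInvGlue.zero_of_nonpos (by nlinarith), zero_div]
      antitoneOn := fun a ha b _ hab => by
        have ha : 0 ≤ a := ha
        exact div_le_div_of_nonneg_right (expNegInvGlue.monotone (by gcongr)) hmass.le
      primitive_eq_one := by
        rw [primitive, intervalIntegral.integral_div]
        exact div_self hmass.ne' }⟩

namespace IsEvenBump

variable {φ : ℝ → ℝ}

theorem primitive_of_le (hφ : IsEvenBump δ φ) (ht : δ ≤ t) : primitive φ t = 1 := by
  rw [primitive_eq_add_of_eq_const hφ.smooth.continuous hφ.eq_zero ht, mul_zero, add_zero,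
    hφ.primitive_eq_one]

theorem monotone_primitive (hφ : IsEvenBump δ φ) : Monotone (primitive φ) :=
  monotone_of_deriv_nonneg ((contDiff_primitive hφ.smooth).differentiable (by simp)) fun t =>
    (deriv_primitive hφ.smooth.continuous).symm ▸ hφ.nonneg t

theorem primitive_le_one (hφ : IsEvenBump δ φ) (t : ℝ) : primitive φ t ≤ 1 :=
  (hφ.monotone_primitive (le_max_left t δ)).trans_eq (hφ.primitive_of_le (le_max_right t δ))

theorem neg_one_le_primitive (hφ : IsEvenBump δ φ) (t : ℝ) : -1 ≤ primitive φ t :=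
  neg_le.1 (odd_primitive hφ.even t ▸ hφ.primitive_le_one (-t))

theorem mul_one_sub_primitive_le (hφ : IsEvenBump δ φ) {k : ℝ} (hk : 0 ≤ k) (hkδ : k * δ ≤ 1)
    (ht : 0 ≤ t) : k * (1 - primitive φ t) ≤ φ t := by
  rcases le_total t δ with htδ | htδ
  · have hint (a b : ℝ) : IntervalIntegrable φ volume a b :=
      hφ.smooth.continuous.intervalIntegrable a b
    have htail : 1 - primitive φ t ≤ (δ - t) * φ t :=
      calc 1 - primitive φ t = ∫ s in t..δ, φ s := by
            rw [← hφ.primitive_eq_one, primitive_sub_primitive hφ.smooth.continuous]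
        _ ≤ ∫ _ in t..δ, φ t := integral_mono_on htδ (hint _ _) (by simp) fun s hs =>
            hφ.antitoneOn ht (ht.trans hs.1) hs.1
        _ = (δ - t) * φ t := by rw [intervalIntegral.integral_const, smul_eq_mul]
    have hφt := hφ.nonneg t
    calc k * (1 - primitive φ t) ≤ k * ((δ - t) * φ t) := by gcongr
      _ ≤ k * (δ * φ t) := by gcongr; linarith
      _ = k * δ * φ t := by ring
      _ ≤ φ t := mul_le_of_le_one_left hφt hkδ
  · simpa only [hφ.primitive_of_le htδ, sub_self, mul_zero] using hφ.nonneg t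

theorem primitive_primitive_lt (hφ : IsEvenBump δ φ) (hδ : 0 < δ) :
    primitive (primitive φ) δ < δ :=
  calc primitive (primitive φ) δ < ∫ _ in (0 : ℝ)..δ, (1 : ℝ) :=
        integral_lt_integral_of_continuousOn_of_le_of_exists_lt hδ
          (contDiff_primitive hφ.smooth).continuous.continuousOn continuousOn_const
          (fun t _ => hφ.primitive_le_one t)
          ⟨0, ⟨le_rfl, hδ.le⟩, primitive_zero.trans_lt one_pos⟩
    _ = δ := by simp

theorem primitive_primitive_nonneg (hφ : IsEvenBump δ φ) (t : ℝ) :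
    0 ≤ primitive (primitive φ) t := by
  wlog ht : 0 ≤ t generalizing t
  · rw [← even_primitive (odd_primitive hφ.even)]
    exact this (-t) (by linarith)
  exact integral_nonneg ht fun s hs => primitive_zero.symm.trans_le (hφ.monotone_primitive hs.1)

theorem isCompression (hφ : IsEvenBump δ φ) (hδ : 0 < δ) {k : ℝ} (hk : 0 ≤ k) (hkδ : k * δ ≤ 1) :
    IsCompression k δ
      (fun t => (δ - primitive (primitive φ) δ) + primitive (primitive φ) t) := by
  have hsmooth := contDiff_primitive hφ.smooth
  have hodd := odd_primitive hφ.even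
  have heven := even_primitive hodd
  have hright (t : ℝ) (ht : δ ≤ t) :
      (δ - primitive (primitive φ) δ) + primitive (primitive φ) t = t := by
    rw [primitive_eq_add_of_eq_const hsmooth.continuous (fun _ => hφ.primitive_of_le) ht]
    ring
  have hderiv : deriv (fun t => (δ - primitive (primitive φ) δ) + primitive (primitive φ) t) =
      primitive φ := by
    rw [deriv_const_add', deriv_primitive hsmooth.continuous]
  have hderiv2 := deriv_primitive hφ.smooth.continuous
  exact
    { smooth := contDiff_const.add (contDiff_primitive hsmooth)
      pos := fun t => add_pos_of_pos_of_nonneg (sub_pos.2 (hφ.primitive_primitive_lt hδ))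
        (hφ.primitive_primitive_nonneg t)
      left := fun t ht => by rw [← heven t, hright (-t) (by linarith)]
      right := hright
      even := fun t => by rw [heven t]
      abs_deriv_le := fun t => by
        rw [hderiv]
        exact abs_le.2 ⟨hφ.neg_one_le_primitive t, hφ.primitive_le_one t⟩
      convex := fun t => by
        rw [hderiv, hderiv2]
        exact hφ.nonneg t
      growth_left := fun t ht => by
        rw [hderiv, hderiv2, abs_of_nonneg (by linarith [hφ.neg_one_le_primitive t]),
          abs_of_nonneg (hφ.nonneg t)]
        have hgrowth := hφ.mul_one_sub_primitive_le hk hkδ (neg_nonneg.2 ht)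
        rwa [hφ.even, hodd, sub_neg_eq_add, add_comm] at hgrowth
      growth_right := fun t ht => by
        rw [hderiv, hderiv2, abs_sub_comm, abs_of_nonneg (by linarith [hφ.primitive_le_one t]),
          abs_of_nonneg (hφ.nonneg t)]
        exact hφ.mul_one_sub_primitive_le hk hkδ ht }

end IsEvenBump

theorem exists_isCompression_lt {k ε : ℝ} (hk : 0 ≤ k) (hε : 0 < ε) :
    ∃ δ h, 0 < δ ∧ δ < ε ∧ IsCompression k δ h := by
  obtain ⟨δ, hδ, hδε⟩ := exists_between (lt_min hε (show 0 < 1 / (k + 1) by positivity))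
  have hkδ : k * δ ≤ 1 := by
    have hδk := (le_div_iff₀ (by positivity)).1 (hδε.trans_le (min_le_right _ _)).le
    linarith
  obtain ⟨φ, hφ⟩ := exists_isEvenBump hδ
  exact ⟨δ, _, hδ, hδε.trans_le (min_le_left _ _), hφ.isCompression hδ hk hkδ⟩

end Primitive

/-! ### Compressing the normal variable -/

section Extension

variable {k δ σ t : ℝ} {h : ℝ → ℝ}

theorem IsCompression.le_delta_of_abs_le (H : IsCompression k δ h) (ht : |t| ≤ δ) : h t ≤ δ := by
  have hle := H.le_delta ⟨abs_nonneg t, ht⟩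
  rcases abs_choice t with habs | habs <;> rw [habs] at hle
  exacts [hle, H.even t ▸ hle]

theorem IsCompression.mapsTo_Ico (H : IsCompression k δ h) (hσ : δ < σ) :
    Set.MapsTo h (Set.Ico 0 σ) (Set.Ioo (-σ) σ) := by
  intro t ht
  refine ⟨by linarith [H.pos t, ht.1, ht.2], ?_⟩
  rcases le_total t δ with htδ | htδ
  · exact (H.le_delta ⟨ht.1, htδ⟩).trans_lt hσ
  · exact (H.right t htδ).trans_lt ht.2

/-- A convex combination of `h` and the identity with a cut-off function as weight agrees with `h`
for `t ≥ 0` and moves only the points of `[-δ/2, δ)`. -/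
theorem IsCompression.exists_extension (H : IsCompression k δ h) (hδ : 0 < δ) (hσ : δ < σ) :
    ∃ η : ℝ → ℝ, ContDiff ℝ ∞ η ∧ Set.MapsTo η (Set.Ioo (-σ) σ) (Set.Ioo (-σ) σ) ∧
      (∀ t, t ∉ Set.Ico (-(δ / 2)) δ → η t = t) ∧ ∀ t, 0 ≤ t → η =ᶠ[𝓝 t] h := by
  obtain ⟨χ, hχ₀, hχ₁, hχ⟩ := exists_contMDiffMap_zero_one_of_isClosed 𝓘(ℝ, ℝ) (n := ⊤)
    (isClosed_Iic (a := -(δ / 2))) (isClosed_Ici (a := -(δ / 4)))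
    (Set.Iic_disjoint_Ici.2 (by linarith))
  have hχ_smooth : ContDiff ℝ ∞ χ := χ.contMDiff.contDiff
  set η : ℝ → ℝ := fun t => χ t * h t + (1 - χ t) * t
  have hη_eq (t : ℝ) (ht : -(δ / 4) ≤ t) : η t = h t := by
    simp [η, hχ₁ ht]
  have hη_self (t : ℝ) (ht : t ∉ Set.Ico (-(δ / 2)) δ) : η t = t := by
    rcases lt_or_ge t (-(δ / 2)) with hlt | hge
    · simp [η, hχ₀ hlt.le]
    · have hle : δ ≤ t := not_lt.1 fun h => ht ⟨hge, h⟩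
      rw [hη_eq t (by linarith), H.right t hle]
  refine ⟨η, ?_, fun t ht => ?_, hη_self, fun t ht => ?_⟩
  · exact (hχ_smooth.mul H.smooth).add ((contDiff_const.sub hχ_smooth).mul contDiff_id)
  · by_cases hmem : t ∈ Set.Ico (-(δ / 2)) δ
    · have hle : h t ≤ δ := H.le_delta_of_abs_le (abs_le.2 ⟨by linarith [hmem.1], hmem.2.le⟩)
      exact (convex_Ioo (-σ) σ) ⟨by linarith [H.pos t], by linarith⟩ ht (hχ t).1
        (sub_nonneg.2 (hχ t).2) (by ring)
    · rwa [hη_self t hmem]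
  · filter_upwards [Ioi_mem_nhds (show -(δ / 4) < t by linarith)] with s hs
    exact hη_eq s (Set.mem_Ioi.1 hs).le

end Extension

section Replacement

variable {m n : ℕ} {H : Type*} [TopologicalSpace H] [ChartedSpace (𝔼 m) H] [IsManifold (𝓡 m) ∞ H]
  {W : Type*} [TopologicalSpace W] [ChartedSpace (𝔼 n) W]
  {Φ : ℝ × W → H} {g g' : Metric m H} {ι : W → H} {ν : ∀ p : W, TangentSpace (𝓡 m) (ι p)}
  {σ t : ℝ} {h : ℝ → ℝ}

theorem IsFermi.hasForm_of_isBentAt (hΦ : IsFermi (n := n) g ι ν σ Φ) {T : Set ℝ}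
    (hT : T ⊆ Set.Ioo (-σ) σ) (hmaps : Set.MapsTo h T (Set.Ioo (-σ) σ))
    (hg : ∀ t ∈ T, IsBentAt n (innerAt g) (innerAt g') Φ h t) :
    HasForm g' Φ T (fun t => sliceMetric (n := n) g Φ (h t)) := by
  intro t ht p
  have hd := hΦ.mdifferentiableAt (hT ht) p
  have hd' := hΦ.mdifferentiableAt (hmaps ht) p
  have hform := hΦ.isFermiForm_fermiPullback (hmaps ht) p
  rw [← hg t ht p] at hform
  refine ⟨?_, fun v => ?_, fun v w => ?_⟩
  · rw [dt_eq_dPhi hd]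
    exact hform.apply_dt _
  · rw [dt_eq_dPhi hd, dslice_eq_dPhi hd]
    exact hform.apply_dt _
  · simp only [sliceMetric]
    rw [dslice_eq_dPhi hd, dslice_eq_dPhi hd, dslice_eq_dPhi hd', dslice_eq_dPhi hd']
    exact DFunLike.congr_fun (DFunLike.congr_fun (hg t ht p) (0, v)) (0, w)

theorem IsFermi.exists_compressedMetric [T2Space H] [CompactSpace W] [IsManifold (𝓡 n) ∞ W]
    (hΦ : IsFermi (n := n) g ι ν σ Φ) {k δ : ℝ} (hh : IsCompression k δ h) (hδ : 0 < δ)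
    (hδσ : δ < σ) :
    ∃ g' : Metric m H,
      (∀ t ∈ Set.Ico 0 σ, ∀ᶠ t' in 𝓝 t, IsBentAt n (innerAt g) (innerAt g') Φ h t') ∧
      ∀ x, x ∉ Φ '' (Set.Ico (-(δ / 2)) δ ×ˢ (Set.univ : Set W)) →
        innerAt g' x = innerAt g x := by
  obtain ⟨η, hsmooth, hmaps, hη_self, hη_eq⟩ := hh.exists_extension hδ hδσ
  obtain ⟨g', hbent, hself⟩ := hΦ.exists_bentMetric hsmooth hmaps (a := -(δ / 2)) (b := δ)
    (by linarith) hδσ fun t ht => hη_self t fun h => ht (Set.Ico_subset_Icc_self h)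
  refine ⟨g', fun t ht => ?_, fun x hx => hself x fun t _ p hp => hη_self t fun h =>
    hx ⟨(t, p), ⟨h, trivial⟩, hp⟩⟩
  filter_upwards [hη_eq t ht.1, Ioo_mem_nhds (by linarith [ht.1, ht.2] : -σ < t) ht.2]
    with s hs hsσ p
  rw [← hs]
  exact hbent s hsσ p

theorem IsFermi.exists_image_subset [CompactSpace W] (hΦ : IsFermi (n := n) g ι ν σ Φ)
    {U : Set H} (hU : U ∈ 𝓝ˢ (Set.range ι)) :
    ∃ ε, 0 < ε ∧ ∀ δ, δ ≤ ε → Φ '' (Set.Ioo (-δ) δ ×ˢ (Set.univ : Set W)) ⊆ U := by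
  have hnear : ∀ᶠ t in 𝓝 (0 : ℝ), ∀ p ∈ (Set.univ : Set W), Φ (t, p) ∈ U := by
    refine isCompact_univ.eventually_forall_of_forall_eventually fun p _ => ?_
    have hp : U ∈ 𝓝 (Φ (0, p)) := mem_nhdsSet_iff_forall.1 hU _ ⟨p, congrFun hΦ.apply_zero p⟩
    exact (hΦ.contMDiffAt hΦ.zero_mem p).continuousAt hp
  obtain ⟨ε, hε, hball⟩ := Metric.eventually_nhds_iff.1 hnear
  refine ⟨ε, hε, fun δ hδ => ?_⟩
  rintro _ ⟨⟨t, p⟩, ⟨ht, -⟩, rfl⟩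
  exact hball (by simpa using (abs_lt.2 ht).trans_le hδ) p trivial

/-- At the points `Φ (t, q)` with `q ∈ s` and `0 ≤ t ≤ δ ≤ σ₁`, replacing `dt² + g_t` by
`dt² + g_{h t}` does not decrease the scalar curvature if `h` is a compression with constants
`k ≥ k₀` and `δ`. The replacement is required in a neighbourhood of `t`, since the scalar curvature
involves derivatives of the metric. -/
def ScalIncreases (n : ℕ) [ChartedSpace (𝔼 n) W] (g : Metric m H) (Φ : ℝ × W → H) (σ₁ k₀ : ℝ)
    (s : Set W) : Prop :=
  ∀ k δ : ℝ, k₀ ≤ k → δ ≤ σ₁ → ∀ h : ℝ → ℝ, IsCompression k δ h → ∀ t ∈ Set.Icc 0 δ, ∀ q ∈ s,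
    ∀ g' : Metric m H, (∀ᶠ t' in 𝓝 t, IsBentAt n (innerAt g) (innerAt g') Φ h t') →
      scal g (Φ (t, q)) ≤ scal g' (Φ (t, q))

theorem ScalIncreases.mono {σ₁ σ₁' k₀ k₀' : ℝ} {s s' : Set W} (hs : ScalIncreases n g Φ σ₁ k₀ s)
    (hσ : σ₁' ≤ σ₁) (hk : k₀ ≤ k₀') (hss' : s' ⊆ s) : ScalIncreases n g Φ σ₁' k₀' s' :=
  fun k δ hk' hδ h hh t ht q hq => hs k δ (hk.trans hk') (hδ.trans hσ) h hh t ht q (hss' hq)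

theorem ScalIncreases.union {σ₁ k₀ : ℝ} {s s' : Set W} (hs : ScalIncreases n g Φ σ₁ k₀ s)
    (hs' : ScalIncreases n g Φ σ₁ k₀ s') : ScalIncreases n g Φ σ₁ k₀ (s ∪ s') :=
  fun k δ hk hδ h hh t ht q hq =>
    hq.elim (hs k δ hk hδ h hh t ht q) (hs' k δ hk hδ h hh t ht q)

theorem IsFermi.scal_le_of_scalIncreases [T2Space H] [CompactSpace W]
    (hΦ : IsFermi (n := n) g ι ν σ Φ) {σ₁ k₀ k δ : ℝ}
    (hs : ScalIncreases n g Φ σ₁ k₀ Set.univ) (hk : k₀ ≤ k) (hδ : 0 < δ) (hδσ₁ : δ ≤ σ₁)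
    (hδσ : δ < σ) (hh : IsCompression k δ h)
    (hbent : ∀ t ∈ Set.Ico 0 σ, ∀ᶠ t' in 𝓝 t, IsBentAt n (innerAt g) (innerAt g') Φ h t')
    (hself : ∀ x, x ∉ Φ '' (Set.Ico (-(δ / 2)) δ ×ˢ (Set.univ : Set W)) →
      innerAt g' x = innerAt g x)
    {x : H} (hx : x ∉ Φ '' (Set.Ioo (-δ) 0 ×ˢ (Set.univ : Set W))) : scal g x ≤ scal g' x := by
  by_cases himage : x ∈ Φ '' (Set.Icc (-(δ / 2)) δ ×ˢ (Set.univ : Set W))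
  · obtain ⟨⟨t, p⟩, ⟨ht, -⟩, rfl⟩ := himage
    have ht₀ : 0 ≤ t := not_lt.1 fun ht₀ =>
      hx ⟨(t, p), ⟨⟨by linarith [ht.1], ht₀⟩, trivial⟩, rfl⟩
    exact hs k δ hk hδσ₁ h hh t ⟨ht₀, ht.2⟩ p trivial g' (hbent t ⟨ht₀, ht.2.trans_lt hδσ⟩)
  · have hclosed := hΦ.isClosed_image (a := -(δ / 2)) (b := δ) (by linarith) hδσ
    refine (scal_congr ?_).ge
    filter_upwards [hclosed.isOpen_compl.mem_nhds himage] with y hy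
    exact hself y fun hy' => hy (Set.image_mono (Set.prod_mono_left Set.Ico_subset_Icc_self) hy')

variable [IsManifold (𝓡 n) ∞ W]

theorem IsFermi.pullback_fermiChart_eventuallyEq (hΦ : IsFermi (n := n) g ι ν σ Φ) {p : W}
    {z : ℝ × 𝔼 n} (hz : z ∈ fermiDomain n σ p) (hh : ContinuousAt h z.1)
    (hhz : h z.1 ∈ Set.Ioo (-σ) σ) {s s' : H → Form (𝔼 m)}
    (hs : ∀ᶠ t in 𝓝 z.1, IsBentAt n s s' Φ h t) :
    pullback s' (fermiChart n Φ p) =ᶠ[𝓝 z]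
      fun z => pullback s (fermiChart n Φ p) (h z.1, z.2) := by
  filter_upwards [(isOpen_fermiDomain σ p).mem_nhds hz, continuousAt_fst.eventually hs,
    continuousAt_fst.eventually (hh (isOpen_Ioo.mem_nhds hhz))] with z hz hs hhz
  exact hΦ.pullback_fermiChart_of_isBentAt hz hhz hs

theorem IsFermi.isTotallyGeodesic_of_isBentAt (hΦ : IsFermi (n := n) g ι ν σ Φ)
    (hh : DifferentiableAt ℝ h 0) (hh₀ : deriv h 0 = 0) (hhσ : h 0 ∈ Set.Ioo (-σ) σ)
    (hg : ∀ᶠ t in 𝓝 (0 : ℝ), IsBentAt n (innerAt g) (innerAt g') Φ h t) :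
    IsTotallyGeodesic (n := n) g' ι := by
  have hz (p : W) := mem_fermiDomain_self (n := n) hΦ.zero_mem p
  have hpull (p : W) :=
    hΦ.pullback_fermiChart_eventuallyEq (hz p) hh.continuousAt hhσ hg
  have hwarp (p : W) : (h 0, extChartAt (𝓡 n) p p) ∈ fermiDomain n σ p := ⟨hhσ, (hz p).2⟩
  refine hΦ.isTotallyGeodesic g' (fun p => ?_) fun p => ?_
  · have hcont : ContinuousAt (fun z : ℝ × 𝔼 n => (h z.1, z.2)) (0, extChartAt (𝓡 n) p p) :=
      (hasFDerivAt_warp hh).continuousAt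
    filter_upwards [hpull p, hcont ((isOpen_fermiDomain σ p).mem_nhds (hwarp p))] with z hz hmem
    exact hz ▸ hΦ.isFermiForm hmem
  · have hG := (contDiffAt_pullback g (hΦ.isParamAt_fermiChart (hwarp p)).contMDiffAt
      ).differentiableAt (by simp)
    rw [(hpull p).fderiv_eq, fderiv_warp hh hG, ContinuousLinearMap.comp_apply, hh₀, stretch_apply,
      zero_mul]
    exact map_zero _

theorem IsFermi.exists_scalIncreases_nhds (hΦ : IsFermi (n := n) g ι ν σ Φ) (p : W)
    (hmean : 0 < meanCurvature (n := n) g ι ν p) :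
    ∃ s ∈ 𝓝 p, ∃ σ₁, 0 < σ₁ ∧ σ₁ < σ ∧ ∃ k₀, ScalIncreases n g Φ σ₁ k₀ s := by
  rw [hΦ.meanCurvature_eq p] at hmean
  obtain ⟨N, hN, hNV, σ₁, hσ₁, hσ₁σ, k₀, hscal⟩ := exists_scalCoord_le_warp hΦ.pos
    (isOpen_extChartAt_target (I := 𝓡 n) p) (mem_extChartAt_target p)
    (fun z hz =>
      contDiffAt_infty.1 (contDiffAt_pullback g (hΦ.isParamAt_fermiChart hz).contMDiffAt) 3)
    (fun z hz => hΦ.isFermiForm hz) (by linarith)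
  refine ⟨(extChartAt (𝓡 n) p).source ∩ extChartAt (𝓡 n) p ⁻¹' N,
    Filter.inter_mem (extChartAt_source_mem_nhds p) (continuousAt_extChartAt p hN),
    σ₁, hσ₁, hσ₁σ, k₀, fun k δ hk hδ h hh t ht q hq g' hg' => ?_⟩
  have hδσ : δ < σ := hδ.trans_lt hσ₁σ
  have htσ : t ∈ Set.Ico 0 σ := ⟨ht.1, ht.2.trans_lt hδσ⟩
  have hz : (t, extChartAt (𝓡 n) p q) ∈ fermiDomain n σ p :=
    ⟨⟨by linarith [htσ.1, htσ.2], htσ.2⟩, hNV hq.2⟩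
  have hparam := hΦ.isParamAt_fermiChart hz
  have hpoint : fermiChart n Φ p (t, extChartAt (𝓡 n) p q) = Φ (t, q) := by
    exact congrArg (fun q' => Φ (t, q')) ((extChartAt (𝓡 n) p).left_inv hq.1)
  rw [← hpoint, hparam.scal_eq_scalCoord_pullback g, hparam.scal_eq_scalCoord_pullback g']
  refine (hscal k δ hk hδ h hh t ht _ hq.2).trans_eq (scalCoord_congr ?_)
  exact (hΦ.pullback_fermiChart_eventuallyEq hz hh.smooth.continuous.continuousAt
    (hh.mapsTo_Ico hδσ htσ) hg').symm

theorem IsFermi.exists_scalIncreases [CompactSpace W] (hΦ : IsFermi (n := n) g ι ν σ Φ)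
    (hmean : ∀ p : W, 0 < meanCurvature (n := n) g ι ν p) :
    ∃ σ₁, 0 < σ₁ ∧ σ₁ < σ ∧ ∃ k₀, ScalIncreases n g Φ σ₁ k₀ Set.univ := by
  refine isCompact_univ.induction_on
    (p := fun s => ∃ σ₁, 0 < σ₁ ∧ σ₁ < σ ∧ ∃ k₀, ScalIncreases n g Φ σ₁ k₀ s)
    ⟨σ / 2, half_pos hΦ.pos, half_lt_self hΦ.pos, 0, fun _ _ _ _ _ _ _ _ _ hq => hq.elim⟩
    ?_ ?_ fun p _ => ?_
  · rintro s s' hss' ⟨σ₁, hσ₁, hσ₁σ, k₀, hs'⟩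
    exact ⟨σ₁, hσ₁, hσ₁σ, k₀, hs'.mono le_rfl le_rfl hss'⟩
  · rintro s s' ⟨a, ha, haσ, k, hs⟩ ⟨b, hb, -, l, hs'⟩
    exact ⟨min a b, lt_min ha hb, (min_le_left _ _).trans_lt haσ, max k l,
      (hs.mono (min_le_left _ _) (le_max_left _ _) subset_rfl).union
        (hs'.mono (min_le_right _ _) (le_max_right _ _) subset_rfl)⟩
  · obtain ⟨s, hs, hscal⟩ := hΦ.exists_scalIncreases_nhds p (hmean p)
    exact ⟨s, mem_nhdsWithin_of_mem_nhds hs, hscal⟩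

theorem IsFermi.exists_isReplacement [T2Space H] [CompactSpace W]
    (hΦ : IsFermi (n := n) g ι ν σ Φ) {σ₁ k₀ k δ : ℝ}
    (hs : ScalIncreases n g Φ σ₁ k₀ Set.univ) (hk : k₀ ≤ k) (hδ : 0 < δ) (hδσ₁ : δ ≤ σ₁)
    (hδσ : δ < σ) (hh : IsCompression k δ h) :
    ∃ g' : Metric m H, IsReplacement (n := n) g Φ σ δ h g' ∧
      (∀ x, x ∉ Φ '' (Set.Ioo (-δ) 0 ×ˢ (Set.univ : Set W)) → scal g x ≤ scal g' x) ∧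
      IsTotallyGeodesic (n := n) g' ι := by
  obtain ⟨g', hbent, hself⟩ := hΦ.exists_compressedMetric hh hδ hδσ
  have hmaps := hh.mapsTo_Ico hδσ
  have hzero : (0 : ℝ) ∈ Set.Ico 0 σ := ⟨le_rfl, hΦ.pos⟩
  have hIco : Set.Ico 0 σ ⊆ Set.Ioo (-σ) σ := Set.Ico_subset_Ioo_left (neg_lt_zero.2 hΦ.pos)
  have hsubset : Set.Ico (-(δ / 2)) δ ⊆ Set.Ioo (-δ) δ := Set.Ico_subset_Ioo_left (by linarith)
  refine ⟨g',
    { hasForm := hΦ.hasForm_of_isBentAt hIco hmaps fun t ht => (hbent t ht).self_of_nhds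
      eq_off := fun x hx => hself x fun hx' =>
        hx (Set.image_mono (Set.prod_mono_left hsubset) hx') },
    fun x hx => hΦ.scal_le_of_scalIncreases hs hk hδ hδσ₁ hδσ hh hbent hself hx, ?_⟩
  exact hΦ.isTotallyGeodesic_of_isBentAt (hh.differentiable 0) hh.deriv_zero (hmaps hzero)
    (hbent 0 hzero)

end Replacement

end FermiDoubling

end

theorem mainTheorem6 {n : ℕ}
    {H : Type*} [TopologicalSpace H] [T2Space H]
    [ChartedSpace (EuclideanSpace ℝ (Fin (n + 1))) H] [IsManifold (𝓡 (n + 1)) ∞ H]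
    {W : Type*} [TopologicalSpace W] [CompactSpace W]
    [ChartedSpace (EuclideanSpace ℝ (Fin n)) W] [IsManifold (𝓡 n) ∞ W]
    (g : FermiDoubling.Metric (n + 1) H)
    (ι : W → H) (_hι : Manifold.IsSmoothEmbedding (𝓡 n) (𝓡 (n + 1)) ∞ ι)
    (ν : ∀ p : W, TangentSpace (𝓡 (n + 1)) (ι p))
    (hmean : ∀ p : W, 0 < FermiDoubling.meanCurvature (n := n) g ι ν p)
    (σ : ℝ) (Φ : ℝ × W → H) (hΦ : FermiDoubling.IsFermi (n := n) g ι ν σ Φ) :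
    ∃ σ₁ : ℝ, 0 < σ₁ ∧ σ₁ ≤ σ ∧ ∃ k₀ : ℝ, 0 < k₀ ∧ ∀ k : ℝ, k₀ ≤ k →
      (∀ (δ : ℝ) (h : ℝ → ℝ), 0 < δ → δ < σ₁ / 2 → FermiDoubling.IsCompression k δ h →
        ∃ g' : FermiDoubling.Metric (n + 1) H,
          FermiDoubling.IsReplacement (n := n) g Φ σ δ h g' ∧
          (∀ x, x ∉ Φ '' (Set.Ioo (-δ) 0 ×ˢ Set.univ) →
            FermiDoubling.scal g x ≤ FermiDoubling.scal g' x) ∧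
          FermiDoubling.IsTotallyGeodesic (n := n) g' ι) ∧
      (∀ U ∈ 𝓝ˢ (Set.range ι), ∃ (δ : ℝ) (h : ℝ → ℝ) (g' : FermiDoubling.Metric (n + 1) H),
          0 < δ ∧ δ < σ₁ / 2 ∧ FermiDoubling.IsCompression k δ h ∧
          FermiDoubling.IsReplacement (n := n) g Φ σ δ h g' ∧
          (∀ x, x ∉ Φ '' (Set.Ioo (-δ) 0 ×ˢ Set.univ) →
            FermiDoubling.scal g x ≤ FermiDoubling.scal g' x) ∧
          FermiDoubling.IsTotallyGeodesic (n := n) g' ι ∧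
          ∀ x, x ∉ U → g'.inner x = g.inner x) := by
  obtain ⟨σ₁, hσ₁, hσ₁σ, k₀, hscal⟩ := hΦ.exists_scalIncreases hmean
  refine ⟨σ₁, hσ₁, hσ₁σ.le, max k₀ 1, by positivity, fun k hk => ?_⟩
  obtain ⟨hk₀, hk₁⟩ := max_le_iff.1 hk
  have hreplace (δ : ℝ) (h : ℝ → ℝ) (hδ : 0 < δ) (hδσ₁ : δ < σ₁ / 2)
      (hh : FermiDoubling.IsCompression k δ h) :=
    hΦ.exists_isReplacement hscal hk₀ hδ (by linarith) (by linarith) hh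
  refine ⟨hreplace, fun U hU => ?_⟩
  obtain ⟨ε, hε, hεU⟩ := hΦ.exists_image_subset hU
  obtain ⟨δ, h, hδ, hδ_lt, hh⟩ := FermiDoubling.exists_isCompression_lt
    (zero_le_one.trans hk₁) (lt_min hε (half_pos hσ₁))
  obtain ⟨hδε, hδσ₁⟩ := lt_min_iff.1 hδ_lt
  obtain ⟨g', hg', hle, hgeod⟩ := hreplace δ h hδ hδσ₁ hh
  exact ⟨δ, h, g', hδ, hδσ₁, hh, hg', hle, hgeod,
    fun x hx => hg'.eq_off x fun hx' => hx (hεU δ hδε.le hx')⟩
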